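/- Let $R\subset\mathbb R^2$ be a $2$-dimensional cubiculated region, i.e. a finite union of closed unit squares $[i,i+1]\times[j,j+1]$ with $i,j\in\mathbb Z$ (the elementary squares of $R$). Assume that $R$ is simply connected: every simple closed curve in $R$ can be shrunk continuously to a point inside $R$. Let $G_R$ be the graph whose vertices are the elementary squares of $R$, two of them being adjacent when they share a side; its edges are the dominoes contained in $R$. A domino tiling of $R$ is a set $T$ of dominoes contained in $R$ such that every elementary square of $R$ belongs to exactly one domino of $T$. Let $\mathbb K$ be a field and let $\mathbb K[E]$ be the polynomial ring over $\mathbb K$ with one variable $y_e$ for each domino $e$ contained in $R$; for a set $D$ of dominoes put $y^D=\prod_{e\in D}y_e$. Let - $I_{G_R}$ be the toric ideal of $G_R$, i.e. the kernel of the $\mathbb K$-algebra homomorphism from $\mathbb K[E]$ to the polynomial ring with one variable $x_v$ for each elementary square $v$ of $R$, given by $y_{\{u,v\}}\mapsto x_ux_v$; - $I_{R_{flip}}\subseteq\mathbb K[E]$ be the flip ideal, generated by the binomials $y^{D_1}-y^{D_2}$ where $D_1$ and $D_2$ are, in either order, the pair of horizontal and the pair of vertical dominoes covering a $2\times2$ block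 of elementary squares contained in $R$; - $I_{R_{tiling}}\subseteq\mathbb K[E]$ be the tiling ideal, generated by the binomials $y^{T_1}-y^{T_2}$ where $T_1,T_2$ are domino tilings of $R$. Then for any two distinct domino tilings $T_1,T_2$ of $R$, the binomial $y^{T_1}-y^{T_2}$ lies in the ideal generated by the quadratic binomials $y_{e_1}y_{e_2}-y_{e_3}y_{e_4}$ contained in $I_{G_R}$, and it lies in $I_{R_{flip}}$. In particular, $I_{R_{tiling}}\subseteq I_{R_{flip}}$. -/

import Mathlib

/-- A two-dimensional cubiculated region of the plane: a finite pure two-dimensional cubical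
complex.  It is determined by its finite set of elementary squares; the pair `(i, j)` stands for
the closed unit square `[i, i + 1] × [j, j + 1]`. -/
abbrev CubiculatedRegion : Type := Finset (ℤ × ℤ)

/-- The closed unit square with lower left corner `c`. -/
def unitSquare (c : ℤ × ℤ) : Set (ℝ × ℝ) :=
  Set.Icc (c.1 : ℝ) (c.1 + 1) ×ˢ Set.Icc (c.2 : ℝ) (c.2 + 1)

namespace CubiculatedRegion

/-- The subset of the plane covered by the region. -/
def carrier (R : CubiculatedRegion) : Set (ℝ × ℝ) :=
  ⋃ c ∈ R, unitSquare c

/-- Every simple closed curve in the region (a loop that is injective except that its two end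
points coincide) can be shrunk continuously to a point inside the region. -/
def IsSimplyConnected (R : CubiculatedRegion) : Prop :=
  ∀ (x : R.carrier) (γ : Path x x), Set.InjOn γ (Set.Iio 1) → γ.Homotopic (Path.refl x)

/-- The graph of the region: the vertices are the elementary squares, and two of them are adjacent
when they share a side, that is, when they agree in one coordinate and differ by one in the
other. -/
def graph (R : CubiculatedRegion) : SimpleGraph R where
  Adj a b := (a.1.1 - b.1.1).natAbs + (a.1.2 - b.1.2).natAbs = 1
  symm := ⟨fun a b h => by omega⟩
  loopless := ⟨fun a h => by omega⟩

/-- The dominoes contained in the region: pairs of elementary squares sharing a side. -/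
abbrev Domino (R : CubiculatedRegion) : Type := R.graph.edgeSet

/-- A domino tiling: every elementary square is covered by exactly one domino. -/
def IsTiling (R : CubiculatedRegion) (T : Finset R.Domino) : Prop :=
  ∀ c : R, ∃! d : R.Domino, d ∈ T ∧ c ∈ d.1

/-- The local flips: the four squares `a`, `b`, `c`, `d` (lower left, lower right, upper right,
upper left) of a `2 × 2` block contained in the region carry two horizontal dominoes
`{a, b}`, `{d, c}` and two vertical dominoes `{a, d}`, `{b, c}`, and a flip replaces one of these
two pairs by the other. -/
def IsFlip (R : CubiculatedRegion) (D₁ D₂ : Finset R.Domino) : Prop :=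
  ∃ a b c d : R,
    b.1 = (a.1.1 + 1, a.1.2) ∧ c.1 = (a.1.1 + 1, a.1.2 + 1) ∧ d.1 = (a.1.1, a.1.2 + 1) ∧
    (((∀ e : R.Domino, e ∈ D₁ ↔ e.1 = s(a, b) ∨ e.1 = s(d, c)) ∧
      (∀ e : R.Domino, e ∈ D₂ ↔ e.1 = s(a, d) ∨ e.1 = s(b, c))) ∨
     ((∀ e : R.Domino, e ∈ D₁ ↔ e.1 = s(a, d) ∨ e.1 = s(b, c)) ∧
      (∀ e : R.Domino, e ∈ D₂ ↔ e.1 = s(a, b) ∨ e.1 = s(d, c))))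

section Algebra

variable (K : Type*) [Field K] (R : CubiculatedRegion)

/-- The squarefree monomial `y^D`, the product of the variables `y_e` over the dominoes `e ∈ D`. -/
noncomputable def monom (D : Finset R.Domino) : MvPolynomial R.Domino K :=
  ∏ e ∈ D, MvPolynomial.X e

/-- The binomial `y^{D₁} - y^{D₂}`. -/
noncomputable def binom (D₁ D₂ : Finset R.Domino) : MvPolynomial R.Domino K :=
  R.monom K D₁ - R.monom K D₂

/-- The toric ideal of the graph of the region: the kernel of the map `y_{ {i, j} } ↦ x_i x_j`. -/
noncomputable def toricIdeal : Ideal (MvPolynomial R.Domino K) :=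
  RingHom.ker (MvPolynomial.aeval (R := K)
    (fun e : R.Domino => (e.1.map (MvPolynomial.X : R → MvPolynomial R K)).mul))

/-- The ideal generated by the quadratic binomials lying in the toric ideal. -/
noncomputable def quadraticIdeal : Ideal (MvPolynomial R.Domino K) :=
  Ideal.span {f | f ∈ R.toricIdeal K ∧ ∃ e₁ e₂ e₃ e₄ : R.Domino,
    f = MvPolynomial.X e₁ * MvPolynomial.X e₂ - MvPolynomial.X e₃ * MvPolynomial.X e₄}

/-- The flip ideal, generated by the binomials of the local flips. -/
noncomputable def flipIdeal : Ideal (MvPolynomial R.Domino K) :=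
  Ideal.span {f | ∃ D₁ D₂ : Finset R.Domino, R.IsFlip D₁ D₂ ∧ f = R.binom K D₁ D₂}

/-- The tiling ideal, generated by the binomials of pairs of tilings. -/
noncomputable def tilingIdeal : Ideal (MvPolynomial R.Domino K) :=
  Ideal.span {f | ∃ T₁ T₂ : Finset R.Domino, R.IsTiling T₁ ∧ R.IsTiling T₂ ∧
    f = R.binom K T₁ T₂}

end Algebra

end CubiculatedRegion

/-! The proof follows Thurston's height functions. Superimposing two tilings gives alternating
cycles through the centres of squares; let `D w` be their total winding number about the lattice
point `w`. The increments of `D` are a quarter of the difference of the two height increments. A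
lattice point that is not interior touches a missing square, and a contractible polygon does not
wind around it, so `D` vanishes there (`exists_isStream`).

If `D` is positive somewhere, the set where `D > 0` is closed under uphill steps of the first
height, hence contains a local maximum of it (`exists_local_max`). There two parallel dominoes fill
a block; flipping them lowers `D` by one at that point only. Induction on the sum of `|D|` joins the
tilings by flips, and each flip changes the monomial by a multiple of a flip binomial.

Simple connectedness enters only through `sum_crossing_eq_zero`: once for the vanishing of `D`, once
to exclude closed uphill paths. Winding is measured by lifting through `Complex.exp` and counting
crossings with a ray. -/

open unitInterval

/-! ### Continuous logarithms along loops -/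

/-- A loop that is contractible in `X` has a logarithm that closes up along any nowhere vanishing
continuous function on `X`. -/
theorem Path.Homotopic.exists_log {X : Type*} [TopologicalSpace X] {x : X} {γ : Path x x}
    (h : γ.Homotopic (Path.refl x)) {f : X → ℂ} (hf : Continuous f) (hf0 : ∀ y, f y ≠ 0) :
    ∃ L : I → ℂ, Continuous L ∧ (∀ t, Complex.exp (L t) = f (γ t)) ∧ L 1 = L 0 := by
  let F : C(X, {z : ℂ // z ≠ 0}) := ⟨fun y => ⟨f y, hf0 y⟩, hf.subtype_mk _⟩
  have hc := Complex.isCoveringMap_exp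
  have hx : F x = ⟨_, (Complex.log (f x)).exp_ne_zero⟩ := by
    apply Subtype.ext
    exact (Complex.exp_log (hf0 x)).symm
  obtain ⟨H⟩ := h.map F
  have h0 : (γ.map F.continuous).toContinuousMap 0 = ⟨_, (Complex.log (f x)).exp_ne_zero⟩ := by
    simpa using hx
  have h1 : ((Path.refl x).map F.continuous).toContinuousMap 0 =
      ⟨_, (Complex.log (f x)).exp_ne_zero⟩ := by
    simpa using hx
  -- Homotopic paths lift to paths with the same endpoint, and the constant path lifts to a
  -- constant.
  have key := hc.liftPath_apply_one_eq_of_homotopicRel ⟨H⟩ (Complex.log (f x)) h0 h1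
  refine ⟨hc.liftPath _ _ h0, map_continuous _, fun t => ?_, ?_⟩
  · have := congrFun (hc.liftPath_lifts _ _ h0) t
    exact congrArg Subtype.val this
  · rw [key, hc.liftPath_zero]
    have : ((Path.refl x).map F.continuous).toContinuousMap = ContinuousMap.const I (F x) := by
      ext; rfl
    have e := hc.liftPath_const hx
    have e2 : hc.liftPath ((Path.refl x).map F.continuous).toContinuousMap _ h1
      = hc.liftPath (ContinuousMap.const I (F x)) _ hx := by
      congr 1
    rw [e2, e]; rfl

/-- Two continuous logarithms of the same function on a preconnected set have the same
increments. -/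
theorem log_increment_eq {Y : Type*} [TopologicalSpace Y] {s : Set Y} (hs : IsPreconnected s)
    {L g : Y → ℂ} (hL : ContinuousOn L s) (hg : ContinuousOn g s)
    (h : ∀ y ∈ s, Complex.exp (L y) = Complex.exp (g y)) {u v : Y} (hu : u ∈ s) (hv : v ∈ s) :
    L v - L u = g v - g u := by
  have hc := Complex.isCoveringMap_exp
  have := hc.isSeparatedMap.eqOn_of_comp_eqOn hc.isLocalHomeomorph.isLocallyInjective hs hL
    (g₂ := fun y => g y + (L u - g u)) (hg.add continuousOn_const) (by
      intro y hy
      apply Subtype.ext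
      change Complex.exp (L y) = Complex.exp (g y + (L u - g u))
      rw [Complex.exp_add, Complex.exp_sub, h u hu, div_self (Complex.exp_ne_zero _), mul_one,
        h y hy]) hu (by simp) hv
  simp only at this
  rw [this]; ring

/-! ### Piecewise linear paths and lattice steps -/

/-- The piecewise linear interpolation of the values `u 0, …, u n` at the points `0, …, n`. -/
noncomputable def interp (u : ℕ → ℝ) (n : ℕ) (s : ℝ) : ℝ :=
  u 0 + ∑ k ∈ Finset.range n, max 0 (min 1 (s - k)) * (u (k + 1) - u k)

theorem continuous_interp (u : ℕ → ℝ) (n : ℕ) : Continuous (interp u n) := by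
  unfold interp
  fun_prop

theorem interp_succ (u : ℕ → ℝ) (n : ℕ) (s : ℝ) :
    interp u (n + 1) s = interp u n s + max 0 (min 1 (s - n)) * (u (n + 1) - u n) := by
  simp [interp, Finset.sum_range_succ, add_assoc]

theorem interp_of_le (u : ℕ → ℝ) (n : ℕ) (s : ℝ) (h : n ≤ s) : interp u n s = u n := by
  induction n with
  | zero => simp [interp]
  | succ n ih =>
    push_cast at h
    rw [interp_succ, ih (by linarith), min_eq_left (by linarith), max_eq_right (by norm_num)]
    ring

theorem interp_of_mem (u : ℕ → ℝ) {m n : ℕ} (hmn : m < n) {s : ℝ} (h1 : m ≤ s) (h2 : s ≤ m + 1) :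
    interp u n s = u m + (s - m) * (u (m + 1) - u m) := by
  induction n, (Nat.succ_le_of_lt hmn) using Nat.le_induction with
  | base =>
    rw [Nat.succ_eq_add_one, interp_succ, interp_of_le _ _ _ h1, min_eq_right (by linarith),
      max_eq_right (by linarith)]
  | succ n hn ih =>
    have : (m + 1 : ℝ) ≤ n := by exact_mod_cast hn
    rw [interp_succ, ih (by omega), min_eq_right (by linarith), max_eq_left (by linarith)]
    ring

/-- Two points of the integer lattice are neighbours. -/
def LatticeAdj (A B : ℤ × ℤ) : Prop := (A.1 - B.1).natAbs + (A.2 - B.2).natAbs = 1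

theorem LatticeAdj.cases {A B : ℤ × ℤ} (h : LatticeAdj A B) :
    (B.1 = A.1 + 1 ∧ B.2 = A.2) ∨ (B.1 = A.1 - 1 ∧ B.2 = A.2) ∨
    (B.1 = A.1 ∧ B.2 = A.2 + 1) ∨ (B.1 = A.1 ∧ B.2 = A.2 - 1) := by
  unfold LatticeAdj at h
  omega

/-- Half-open lattice edges that meet start at the same point or are reverse to one another. -/
theorem LatticeAdj.eq_or_reverse {A A' B B' : ℤ × ℤ} (hA : LatticeAdj A A') (hB : LatticeAdj B B')
    {r q : ℝ} (hr0 : 0 ≤ r) (hr1 : r < 1) (hq0 : 0 ≤ q) (hq1 : q < 1)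
    (h1 : (A.1 : ℝ) + r * (A'.1 - A.1) = B.1 + q * (B'.1 - B.1))
    (h2 : (A.2 : ℝ) + r * (A'.2 - A.2) = B.2 + q * (B'.2 - B.2)) :
    A = B ∨ (A = B' ∧ A' = B) := by
  have key : ∀ m k : ℤ, (-2 : ℝ) < m - k → (m - k : ℝ) < 2 →
      (m = k - 1 ∧ (m : ℝ) = k - 1) ∨ (m = k ∧ (m : ℝ) = k) ∨ (m = k + 1 ∧ (m : ℝ) = k + 1) := by
    intro m k h1 h2
    have u1 : m - k < 2 := by exact_mod_cast h2
    have u2 : -2 < m - k := by exact_mod_cast h1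
    have : m = k - 1 ∨ m = k ∨ m = k + 1 := by omega
    rcases this with rfl | rfl | rfl <;> simp
  rcases hA.cases with ⟨e1, e2⟩ | ⟨e1, e2⟩ | ⟨e1, e2⟩ | ⟨e1, e2⟩ <;>
  rcases hB.cases with ⟨f1, f2⟩ | ⟨f1, f2⟩ | ⟨f1, f2⟩ | ⟨f1, f2⟩ <;>
  · rw [e1, f1] at h1
    rw [e2, f2] at h2
    push_cast at h1 h2
    simp only [Prod.ext_iff]
    rcases key A.1 B.1 (by linarith) (by linarith) with ⟨k1, k1'⟩ | ⟨k1, k1'⟩ | ⟨k1, k1'⟩ <;>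
    rcases key A.2 B.2 (by linarith) (by linarith) with ⟨k2, k2'⟩ | ⟨k2, k2'⟩ | ⟨k2, k2'⟩ <;>
    first
    | (exfalso; linarith)
    | omega

/-! ### Ray crossings and winding numbers -/

/-- The signed crossing of the lattice step from `A` to `B` with the upward vertical ray that
starts inside the lattice square with lower left corner `q`. -/
def crossing (q A B : ℤ × ℤ) : ℤ :=
  (if A.1 = q.1 ∧ B.1 = q.1 + 1 ∧ q.2 < A.2 then 1 else 0) -
    (if B.1 = q.1 ∧ A.1 = q.1 + 1 ∧ q.2 < B.2 then 1 else 0)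

theorem crossing_swap (q A B : ℤ × ℤ) : crossing q B A = -crossing q A B := by
  unfold crossing
  ring

theorem crossing_self (q A : ℤ × ℤ) : crossing q A A = 0 := by
  unfold crossing
  ring

/-- The vector from `p` to `(x, y)`, turned by a right angle, as a complex number. -/
def turned (p : ℝ × ℝ) (x y : ℝ) : ℂ := ⟨p.2 - y, x - p.1⟩

theorem continuous_turned (p : ℝ × ℝ) : Continuous fun z : ℝ × ℝ => turned p z.1 z.2 := by
  have : (fun z : ℝ × ℝ => turned p z.1 z.2) =
      fun z => ((p.2 - z.2 : ℝ) : ℂ) + ((z.1 - p.1 : ℝ) : ℂ) * Complex.I := by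
    ext z
    apply Complex.ext <;> simp [turned]
  rw [this]
  fun_prop

/-- `turned` sends the upward ray from `p` into the negative real axis, the cut of `Complex.log`. A
step off the ray changes `L` as the principal logarithm does; a step across it adds a full turn,
with the sign recorded by `crossing`. -/
theorem log_increment_step {Y : Type*} [TopologicalSpace Y] {s : Set Y} (hs : IsPreconnected s)
    {L : Y → ℂ} (hL : ContinuousOn L s) {r : Y → ℝ} (hr : ContinuousOn r s)
    (hr0 : ∀ y ∈ s, 0 ≤ r y) (hr1 : ∀ y ∈ s, r y ≤ 1)
    {A B q : ℤ × ℤ} (hAB : LatticeAdj A B) {p : ℝ × ℝ}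
    (h1 : (q.1 : ℝ) < p.1) (h1' : p.1 < q.1 + 1) (h2 : (q.2 : ℝ) < p.2) (h2' : p.2 < q.2 + 1)
    (hexp : ∀ y ∈ s, Complex.exp (L y) =
      turned p (A.1 + r y * (B.1 - A.1)) (A.2 + r y * (B.2 - A.2)))
    {u v : Y} (hu : u ∈ s) (hv : v ∈ s) (hru : r u = 0) (hrv : r v = 1) :
    L v - L u = Complex.log (turned p B.1 B.2) - Complex.log (turned p A.1 A.2)
      - 2 * Real.pi * Complex.I * crossing q A B := by
  set G : Y → ℂ := fun y => turned p (A.1 + r y * (B.1 - A.1)) (A.2 + r y * (B.2 - A.2)) with hG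
  have hGc : ContinuousOn G s := by
    have : ContinuousOn (fun y => ((A.1 + r y * (B.1 - A.1) : ℝ), (A.2 + r y * (B.2 - A.2) : ℝ))) s :=
      by fun_prop
    exact (continuous_turned p).comp_continuousOn this
  have hGu : G u = turned p A.1 A.2 := by simp [hG, hru]
  have hGv : G v = turned p B.1 B.2 := by simp [hG, hrv]
  have hG0 : ∀ y ∈ s, G y ≠ 0 := fun y hy h0 => Complex.exp_ne_zero (L y) ((hexp y hy).trans h0)
  by_cases hcr : q.2 < A.2 ∧ A.2 = B.2 ∧
      ((A.1 = q.1 ∧ B.1 = q.1 + 1) ∨ (B.1 = q.1 ∧ A.1 = q.1 + 1))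
  -- Here `G` stays in the left half plane, so `log (-G)` is continuous. Its ends lie on opposite
  -- sides of the cut, and comparison with the principal logarithm yields two half turns that add
  -- up.
  · have hsl : ∀ y ∈ s, -G y ∈ Complex.slitPlane := by
      intro y hy
      rw [Complex.mem_slitPlane_iff]
      left
      have : (q.2 : ℝ) + 1 ≤ A.2 := by exact_mod_cast hcr.1
      simp only [hG, turned, Complex.neg_re, ← hcr.2.1]
      linarith
    have key := log_increment_eq hs (L := fun y => L y + Real.pi * Complex.I)
      (hL.add continuousOn_const) (hGc.neg.clog hsl)
      (fun y hy => by
        rw [Complex.exp_add_pi_mul_I, hexp y hy, Pi.neg_apply,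
          Complex.exp_log (neg_ne_zero.mpr (hG0 y hy))]) hu hv
    rw [add_sub_add_right_eq_sub, Pi.neg_apply, Pi.neg_apply, hGu, hGv] at key
    rw [key]
    have hneg : ∀ z : ℂ, z.im < 0 → Complex.log (-z) = Complex.log z + Real.pi * Complex.I := by
      intro z hz
      simp only [Complex.log, norm_neg, Complex.arg_neg_eq_arg_add_pi_of_im_neg hz]
      push_cast
      ring
    have hpos : ∀ z : ℂ, 0 < z.im → Complex.log (-z) = Complex.log z - Real.pi * Complex.I := by
      intro z hz
      simp only [Complex.log, norm_neg, Complex.arg_neg_eq_arg_sub_pi_of_im_pos hz]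
      push_cast
      ring
    obtain ⟨d1, d2, ⟨e1, e2⟩ | ⟨e1, e2⟩⟩ := hcr
    · have hc : crossing q A B = 1 := by
        unfold crossing
        rw [if_pos, if_neg] <;> omega
      rw [hpos (turned p B.1 B.2) (by rw [e2]; simp only [turned]; push_cast; linarith),
        hneg (turned p A.1 A.2) (by rw [e1]; simp only [turned]; linarith), hc]
      push_cast
      ring
    · have hc : crossing q A B = -1 := by
        unfold crossing
        rw [if_neg, if_pos] <;> omega
      rw [hneg (turned p B.1 B.2) (by rw [e1]; simp only [turned]; linarith),
        hpos (turned p A.1 A.2) (by rw [e2]; simp only [turned]; push_cast; linarith), hc]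
      push_cast
      ring
  · have hsl : ∀ y ∈ s, G y ∈ Complex.slitPlane := by
      intro y hy
      rw [Complex.mem_slitPlane_iff]
      by_contra! hcon
      obtain ⟨c1, c2⟩ := hcon
      simp only [hG, turned] at c1 c2
      have := hr0 y hy
      have := hr1 y hy
      apply hcr
      rcases hAB.cases with ⟨e1, e2⟩ | ⟨e1, e2⟩ | ⟨e1, e2⟩ | ⟨e1, e2⟩ <;>
        rw [e1] at c2 <;> rw [e2] at c1 <;> push_cast at c1 c2
      · have g1 : (q.1 : ℝ) < A.1 + 1 := by linarith
        have g2 : (A.1 : ℝ) < q.1 + 1 := by linarith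
        have g3 : (q.2 : ℝ) < A.2 := by linarith
        norm_cast at g1 g2 g3
        omega
      · have g1 : (q.1 : ℝ) < A.1 := by linarith
        have g2 : (A.1 : ℝ) < q.1 + 2 := by linarith
        have g3 : (q.2 : ℝ) < A.2 := by linarith
        norm_cast at g1 g2 g3
        omega
      all_goals
        have g1 : (q.1 : ℝ) < A.1 := by linarith
        have g2 : (A.1 : ℝ) < q.1 + 1 := by linarith
        norm_cast at g1 g2
        omega
    have key := log_increment_eq hs hL (hGc.clog hsl) (fun y hy => by
      rw [hexp y hy, Complex.exp_log (hG0 y hy)]) hu hv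
    have hc : crossing q A B = 0 := by
      unfold crossing
      rw [if_neg, if_neg] <;> rcases hAB.cases with h | h | h | h <;> omega
    rw [key, hGu, hGv, hc]
    simp

/-! ### Lattice polygons in a simply connected region -/

namespace CubiculatedRegion

/-- A simple closed lattice polygon in a simply connected region does not wind around a point
outside of the region. -/
theorem IsSimplyConnected.sum_crossing_eq_zero {R : CubiculatedRegion} (hR : R.IsSimplyConnected)
    {n : ℕ} (hn : 3 ≤ n) {c : ℕ → ℤ × ℤ} (hc : c n = c 0) (hinj : Set.InjOn c (Set.Iio n))
    (hadj : ∀ k < n, LatticeAdj (c k) (c (k + 1))) (o : ℝ × ℝ)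
    (hpath : ∀ k < n, ∀ r : ℝ, 0 ≤ r → r ≤ 1 →
      (o.1 + ((c k).1 + r * ((c (k + 1)).1 - (c k).1)),
        o.2 + ((c k).2 + r * ((c (k + 1)).2 - (c k).2))) ∈ R.carrier)
    {p : ℝ × ℝ} (hp : (o.1 + p.1, o.2 + p.2) ∉ R.carrier) {q : ℤ × ℤ}
    (h1 : (q.1 : ℝ) < p.1) (h1' : p.1 < q.1 + 1) (h2 : (q.2 : ℝ) < p.2) (h2' : p.2 < q.2 + 1) :
    ∑ k ∈ Finset.range n, crossing q (c k) (c (k + 1)) = 0 := by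
  have hn0 : (0 : ℝ) < n := by
    have : 0 < n := by omega
    exact_mod_cast this
  set u : ℕ → ℝ := fun k => ((c k).1 : ℝ) with hu
  set v : ℕ → ℝ := fun k => ((c k).2 : ℝ) with hv
  set pos : ℝ → ℝ × ℝ := fun s => (o.1 + interp u n s, o.2 + interp v n s) with hpos
  have hposc : Continuous pos := by
    have := continuous_interp u n
    have := continuous_interp v n
    fun_prop
  have hposm : ∀ m < n, ∀ s : ℝ, m ≤ s → s ≤ m + 1 →
      pos s = (o.1 + ((c m).1 + (s - m) * ((c (m + 1)).1 - (c m).1)),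
        o.2 + ((c m).2 + (s - m) * ((c (m + 1)).2 - (c m).2))) := by
    intro m hm s hs1 hs2
    simp only [hpos, interp_of_mem _ hm hs1 hs2, hu, hv]
  have hfloor : ∀ s : ℝ, 0 ≤ s → s < n → ∃ m < n, (m : ℝ) ≤ s ∧ s < m + 1 := by
    intro s hs0 hsn
    refine ⟨⌊s⌋₊, ?_, Nat.floor_le hs0, Nat.lt_floor_add_one s⟩
    exact (Nat.floor_lt hs0).mpr hsn
  have hposn : pos n = pos 0 := by
    simp only [hpos, interp_of_le _ _ _ le_rfl]
    rw [interp_of_mem u (m := 0) (by omega) (by simp) (by simp),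
      interp_of_mem v (m := 0) (by omega) (by simp) (by simp)]
    simp [hu, hv, hc]
  have hmem : ∀ s : ℝ, 0 ≤ s → s ≤ n → pos s ∈ R.carrier := by
    have hlt : ∀ s : ℝ, 0 ≤ s → s < n → pos s ∈ R.carrier := by
      intro s hs0 hsn
      obtain ⟨m, hm, hm1, hm2⟩ := hfloor s hs0 hsn
      rw [hposm m hm s hm1 hm2.le]
      exact hpath m hm _ (by linarith) (by linarith)
    intro s hs0 hsn
    rcases hsn.lt_or_eq with h | rfl
    · exact hlt s hs0 h
    · rw [hposn]
      exact hlt 0 le_rfl hn0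
  have hI : ∀ t : I, 0 ≤ n * (t : ℝ) ∧ n * (t : ℝ) ≤ n := fun t =>
    ⟨mul_nonneg hn0.le t.2.1, mul_le_of_le_one_right hn0.le t.2.2⟩
  let x : R.carrier := ⟨pos 0, hmem 0 le_rfl hn0.le⟩
  let γ : Path x x :=
    { toFun := fun t => ⟨pos (n * t), hmem _ (hI t).1 (hI t).2⟩
      continuous_toFun := by
        apply Continuous.subtype_mk
        exact hposc.comp (by fun_prop)
      source' := by simp [x]
      target' := by simp [x, hposn] }
  have hγ : Set.InjOn γ (Set.Iio 1) := by
    intro t ht t' ht' heq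
    have heq' : pos (n * t) = pos (n * t') := congrArg Subtype.val heq
    have hlt : ∀ t : I, t ∈ Set.Iio (1 : I) → n * (t : ℝ) < n := by
      intro t ht
      have : (t : ℝ) < 1 := ht
      exact mul_lt_of_lt_one_right hn0 this
    obtain ⟨m, hm, hm1, hm2⟩ := hfloor _ (hI t).1 (hlt t ht)
    obtain ⟨l, hl, hl1, hl2⟩ := hfloor _ (hI t').1 (hlt t' ht')
    rw [hposm m hm _ hm1 hm2.le, hposm l hl _ hl1 hl2.le, Prod.mk.injEq, add_right_inj,
      add_right_inj] at heq'
    have hml : m = l := by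
      rcases (hadj m hm).eq_or_reverse (hadj l hl) (by linarith) (by linarith) (by linarith)
        (by linarith) heq'.1 heq'.2 with h | ⟨ha, hb⟩
      · exact hinj hm hl h
      -- The reverse case would give `m ≡ l + 1` and `l ≡ m + 1` modulo `n`, which is impossible for
      -- `n ≥ 3`.
      · have hnext : ∀ i < n, ∀ j < n, c i = c (j + 1) → i = j + 1 ∨ (j + 1 = n ∧ i = 0) := by
          intro i hi j hj hij
          rcases (show j + 1 < n ∨ j + 1 = n by omega) with h | h
          · exact Or.inl (hinj hi h hij)
          · rw [h, hc] at hij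
            exact Or.inr ⟨h, hinj hi (show 0 < n by omega) hij⟩
        have ha' := hnext m hm l hl ha
        have hb' := hnext l hl m hm hb.symm
        omega
    subst hml
    have hst : (n * (t : ℝ) - m) = n * (t' : ℝ) - m := by
      obtain ⟨e1, e2⟩ := heq'
      rcases (hadj m hm).cases with ⟨f1, f2⟩ | ⟨f1, f2⟩ | ⟨f1, f2⟩ | ⟨f1, f2⟩ <;>
        rw [f1] at e1 <;> rw [f2] at e2 <;> push_cast at e1 e2 <;> linarith
    apply Subtype.ext
    have := sub_left_inj.mp hst
    exact mul_left_cancel₀ hn0.ne' this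
  obtain ⟨L, hLc, hLexp, hL1⟩ := (hR x γ hγ).exists_log
    (f := fun z => turned p (z.1.1 - o.1) (z.1.2 - o.2))
    (by
      have : Continuous fun z : R.carrier => ((z.1.1 - o.1 : ℝ), (z.1.2 - o.2 : ℝ)) := by fun_prop
      exact (continuous_turned p).comp this)
    (by
      intro z hz
      apply hp
      have hre := congrArg Complex.re hz
      have him := congrArg Complex.im hz
      simp only [turned, Complex.zero_re, Complex.zero_im] at hre him
      convert z.2 using 1
      ext <;> simp only <;> linarith)
  let node : ℕ → I := fun k => Set.projIcc 0 1 zero_le_one ((k : ℝ) / n)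
  have hnode : ∀ k ≤ n, n * (node k : ℝ) = k := by
    intro k hk
    have hk' : (k : ℝ) ≤ n := by exact_mod_cast hk
    have : (node k : ℝ) = k / n := by
      simp only [node]
      rw [Set.projIcc_of_mem zero_le_one ⟨by positivity, by rw [div_le_one hn0]; exact hk'⟩]
    rw [this]
    field_simp
  have hstep : ∀ k < n, L (node (k + 1)) - L (node k) =
      (Complex.log (turned p (c (k + 1)).1 (c (k + 1)).2) -
        Complex.log (turned p (c k).1 (c k).2)) -
      2 * Real.pi * Complex.I * crossing q (c k) (c (k + 1)) := by
    intro k hk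
    have hk1 := hnode k hk.le
    have hk2 := hnode (k + 1) hk
    have hle : node k ≤ node (k + 1) := by
      have : (node k : ℝ) ≤ node (k + 1) := by
        apply le_of_mul_le_mul_left _ hn0
        rw [hk1, hk2]
        push_cast
        linarith
      exact this
    have hs : ∀ t ∈ Set.Icc (node k) (node (k + 1)), (k : ℝ) ≤ n * (t : ℝ) ∧
        n * (t : ℝ) ≤ (k : ℝ) + 1 := by
      intro t ht
      have a1 := mul_le_mul_of_nonneg_left (show (node k : ℝ) ≤ t from ht.1) hn0.le
      have a2 := mul_le_mul_of_nonneg_left (show (t : ℝ) ≤ node (k + 1) from ht.2) hn0.le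
      rw [hk1] at a1
      rw [hk2] at a2
      push_cast at a2
      exact ⟨a1, a2⟩
    refine log_increment_step (s := Set.Icc (node k) (node (k + 1))) isPreconnected_Icc
      hLc.continuousOn (r := fun t => n * (t : ℝ) - k) (by fun_prop)
      (fun t ht => by linarith [(hs t ht).1]) (fun t ht => by linarith [(hs t ht).2])
      (hadj k hk) h1 h1' h2 h2' ?_ (Set.left_mem_Icc.mpr hle) (Set.right_mem_Icc.mpr hle)
      (by simp [hk1]) (by simp [hk2])
    intro t ht
    rw [hLexp]
    change turned p ((pos (n * t)).1 - o.1) ((pos (n * t)).2 - o.2) = _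
    rw [hposm k hk _ (hs t ht).1 (hs t ht).2, add_sub_cancel_left, add_sub_cancel_left]
  have hsum : ∑ k ∈ Finset.range n, (L (node (k + 1)) - L (node k)) = 0 := by
    have e0 : node 0 = 0 := by
      apply Subtype.ext
      apply mul_left_cancel₀ hn0.ne'
      rw [hnode 0 (by omega)]
      simp
    have e1 : node n = 1 := by
      apply Subtype.ext
      apply mul_left_cancel₀ hn0.ne'
      rw [hnode n le_rfl]
      simp
    rw [Finset.sum_range_sub (fun k => L (node k)), e0, e1, hL1, sub_self]
  -- The principal logarithms telescope around the closed polygon, leaving only the crossings.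
  rw [Finset.sum_congr rfl (fun k hk => hstep k (Finset.mem_range.mp hk)), Finset.sum_sub_distrib,
    Finset.sum_range_sub (fun k => Complex.log (turned p (c k).1 (c k).2)), hc, sub_self, zero_sub,
    neg_eq_zero, ← Finset.mul_sum, mul_eq_zero] at hsum
  rcases hsum with h | h
  · simp [Real.pi_ne_zero] at h
  · exact_mod_cast h

/-- A lattice point all of whose four incident unit squares belong to the region. -/
def IsInterior (R : CubiculatedRegion) (w : ℤ × ℤ) : Prop :=
  (w.1, w.2) ∈ R ∧ (w.1 - 1, w.2) ∈ R ∧ (w.1, w.2 - 1) ∈ R ∧ (w.1 - 1, w.2 - 1) ∈ R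

theorem mem_carrier_iff {R : CubiculatedRegion} {z : ℝ × ℝ} :
    z ∈ R.carrier ↔ ∃ s ∈ R, ((s.1 : ℝ) ≤ z.1 ∧ z.1 ≤ s.1 + 1) ∧ ((s.2 : ℝ) ≤ z.2 ∧ z.2 ≤ s.2 + 1) := by
  simp only [carrier, unitSquare, Set.mem_iUnion, Set.mem_prod, Set.mem_Icc, exists_prop]

theorem notMem_carrier {R : CubiculatedRegion} {s : ℤ × ℤ} (hs : s ∉ R) {z : ℝ × ℝ}
    (h1 : (s.1 : ℝ) < z.1) (h1' : z.1 < s.1 + 1) (h2 : (s.2 : ℝ) < z.2) (h2' : z.2 < s.2 + 1) :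
    z ∉ R.carrier := by
  rw [mem_carrier_iff]
  rintro ⟨t, ht, ⟨a, b⟩, c, d⟩
  have e1 : (s.1 : ℝ) < t.1 + 1 := by linarith
  have e2 : (t.1 : ℝ) < s.1 + 1 := by linarith
  have e3 : (s.2 : ℝ) < t.2 + 1 := by linarith
  have e4 : (t.2 : ℝ) < s.2 + 1 := by linarith
  norm_cast at e1 e2 e3 e4
  have : s = t := by ext <;> omega
  exact hs (this ▸ ht)

theorem IsSimplyConnected.sum_crossing_vertices {R : CubiculatedRegion} (hR : R.IsSimplyConnected)
    {n : ℕ} (hn : 3 ≤ n) {c : ℕ → ℤ × ℤ} (hc : c n = c 0) (hinj : Set.InjOn c (Set.Iio n))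
    (hadj : ∀ k < n, LatticeAdj (c k) (c (k + 1))) (hint : ∀ k, R.IsInterior (c k))
    {s : ℤ × ℤ} (hs : s ∉ R) : ∑ k ∈ Finset.range n, crossing s (c k) (c (k + 1)) = 0 := by
  refine hR.sum_crossing_eq_zero hn hc hinj hadj (0, 0) ?_ (p := (s.1 + 1 / 2, s.2 + 1 / 2))
    (notMem_carrier hs ?_ ?_ ?_ ?_) ?_ ?_ ?_ ?_
  · intro k hk r hr0 hr1
    rw [mem_carrier_iff]
    obtain ⟨h1, h2, h3, h4⟩ := hint k
    rcases (hadj k hk).cases with ⟨f1, f2⟩ | ⟨f1, f2⟩ | ⟨f1, f2⟩ | ⟨f1, f2⟩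
    · refine ⟨_, h1, ?_⟩
      rw [f1, f2]
      push_cast
      refine ⟨⟨?_, ?_⟩, ?_, ?_⟩ <;> linarith
    · refine ⟨_, h2, ?_⟩
      rw [f1, f2]
      push_cast
      refine ⟨⟨?_, ?_⟩, ?_, ?_⟩ <;> linarith
    · refine ⟨_, h1, ?_⟩
      rw [f1, f2]
      push_cast
      refine ⟨⟨?_, ?_⟩, ?_, ?_⟩ <;> linarith
    · refine ⟨_, h3, ?_⟩
      rw [f1, f2]
      push_cast
      refine ⟨⟨?_, ?_⟩, ?_, ?_⟩ <;> linarith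
  all_goals simp only; linarith

/-- The polygon joins centres of squares, hence the offset `(1/2, 1/2)`; relative to it `w` is the
centre of the unit square with corner `w - (1, 1)`. The point wound around is chosen near `w` in a
missing square. -/
theorem IsSimplyConnected.sum_crossing_squares {R : CubiculatedRegion} (hR : R.IsSimplyConnected)
    {n : ℕ} (hn : 3 ≤ n) {c : ℕ → ℤ × ℤ} (hc : c n = c 0) (hinj : Set.InjOn c (Set.Iio n))
    (hadj : ∀ k < n, LatticeAdj (c k) (c (k + 1))) (hmem : ∀ k, c k ∈ R)
    {w : ℤ × ℤ} (hw : ¬ R.IsInterior w) :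
    ∑ k ∈ Finset.range n, crossing (w.1 - 1, w.2 - 1) (c k) (c (k + 1)) = 0 := by
  obtain ⟨s, hs, hsx, hsy⟩ : ∃ s, s ∉ R ∧ (s.1 = w.1 ∨ s.1 = w.1 - 1) ∧
      (s.2 = w.2 ∨ s.2 = w.2 - 1) := by
    by_contra! hcon
    apply hw
    refine ⟨?_, ?_, ?_, ?_⟩ <;>
    · by_contra h
      have := hcon _ h
      simp at this
  obtain ⟨x, hx1, hx2, hx3, hx4⟩ : ∃ x : ℝ, (s.1 : ℝ) < x ∧ x < s.1 + 1 ∧ (w.1 : ℝ) - 1 / 2 < x ∧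
      x < w.1 + 1 / 2 := by
    rcases hsx with h | h
    · refine ⟨w.1 + 1 / 4, ?_⟩
      rw [h]
      refine ⟨?_, ?_, ?_, ?_⟩ <;> linarith
    · refine ⟨w.1 - 1 / 4, ?_⟩
      rw [h]
      push_cast
      refine ⟨?_, ?_, ?_, ?_⟩ <;> linarith
  obtain ⟨y, hy1, hy2, hy3, hy4⟩ : ∃ y : ℝ, (s.2 : ℝ) < y ∧ y < s.2 + 1 ∧ (w.2 : ℝ) - 1 / 2 < y ∧
      y < w.2 + 1 / 2 := by
    rcases hsy with h | h
    · refine ⟨w.2 + 1 / 4, ?_⟩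
      rw [h]
      refine ⟨?_, ?_, ?_, ?_⟩ <;> linarith
    · refine ⟨w.2 - 1 / 4, ?_⟩
      rw [h]
      push_cast
      refine ⟨?_, ?_, ?_, ?_⟩ <;> linarith
  refine hR.sum_crossing_eq_zero hn hc hinj hadj (1 / 2, 1 / 2) ?_ (p := (x - 1 / 2, y - 1 / 2))
    (notMem_carrier hs ?_ ?_ ?_ ?_) ?_ ?_ ?_ ?_
  · intro k hk r hr0 hr1
    rw [mem_carrier_iff]
    -- Each half of a segment lies in the square whose centre is its nearer end.
    rcases le_or_gt r (1 / 2) with hr | hr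
    · refine ⟨_, hmem k, ?_⟩
      rcases (hadj k hk).cases with ⟨f1, f2⟩ | ⟨f1, f2⟩ | ⟨f1, f2⟩ | ⟨f1, f2⟩ <;>
      · rw [f1, f2]
        push_cast
        refine ⟨⟨?_, ?_⟩, ?_, ?_⟩ <;> linarith
    · refine ⟨_, hmem (k + 1), ?_⟩
      rcases (hadj k hk).cases with ⟨f1, f2⟩ | ⟨f1, f2⟩ | ⟨f1, f2⟩ | ⟨f1, f2⟩ <;>
      · rw [f1, f2]
        push_cast
        refine ⟨⟨?_, ?_⟩, ?_, ?_⟩ <;> linarith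
  all_goals push_cast; linarith

/-! ### Tilings as indicator functions on pairs of squares -/

/-- The set of dominoes `T` contains the domino made of the squares `A` and `B`. -/
def Covers {R : CubiculatedRegion} (T : Finset R.Domino) (A B : ℤ × ℤ) : Prop :=
  ∃ d ∈ T, d.1.map Subtype.val = s(A, B)

variable {R : CubiculatedRegion} {T T₁ T₂ : Finset R.Domino}

theorem Covers.symm {A B : ℤ × ℤ} (h : Covers T A B) : Covers T B A := by
  obtain ⟨d, hd, h⟩ := h
  exact ⟨d, hd, h.trans Sym2.eq_swap⟩

theorem covers_coe_iff {A B : R} : Covers T A.1 B.1 ↔ ∃ d ∈ T, d.1 = s(A, B) := by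
  unfold Covers
  refine exists_congr fun d => and_congr_right fun _ => ?_
  rw [← Sym2.map_mk, (Sym2.map.injective Subtype.val_injective).eq_iff]

theorem Covers.exists_coe {A B : ℤ × ℤ} (h : Covers T A B) : ∃ A' B' : R, A'.1 = A ∧ B'.1 = B := by
  obtain ⟨⟨d, hd⟩, -, h⟩ := h
  induction d using Sym2.ind with
  | _ x y =>
    simp only [Sym2.map_mk, Sym2.eq_iff] at h
    rcases h with ⟨h1, h2⟩ | ⟨h1, h2⟩
    · exact ⟨x, y, h1, h2⟩
    · exact ⟨y, x, h2, h1⟩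

theorem Covers.adj {A B : ℤ × ℤ} (h : Covers T A B) : LatticeAdj A B := by
  obtain ⟨A, B, rfl, rfl⟩ := h.exists_coe
  obtain ⟨⟨d, hd⟩, -, rfl⟩ := covers_coe_iff.mp h
  exact hd

theorem isTiling_iff : R.IsTiling T ↔ ∀ A : R, ∃! B : R, Covers T A.1 B.1 := by
  refine forall_congr' fun A => ⟨?_, ?_⟩
  · rintro ⟨d, ⟨hd, hA⟩, huniq⟩
    refine ⟨Sym2.Mem.other hA, covers_coe_iff.mpr ⟨d, hd, (Sym2.other_spec hA).symm⟩, ?_⟩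
    intro B hB
    obtain ⟨d', hd', hB⟩ := covers_coe_iff.mp hB
    have := huniq d' ⟨hd', by rw [hB]; exact Sym2.mem_mk_left A B⟩
    subst this
    have := (Sym2.other_spec hA).trans hB
    exact (Sym2.congr_right.mp this).symm
  · rintro ⟨B, hB, huniq⟩
    obtain ⟨d, hd, hB⟩ := covers_coe_iff.mp hB
    refine ⟨d, ⟨hd, by rw [hB]; exact Sym2.mem_mk_left A B⟩, ?_⟩
    rintro d' ⟨hd', hA⟩
    have := huniq (Sym2.Mem.other hA) (covers_coe_iff.mpr ⟨d', hd', (Sym2.other_spec hA).symm⟩)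
    apply Subtype.ext
    rw [hB, ← this, Sym2.other_spec hA]

theorem eq_of_covers_iff (h : ∀ A B, Covers T₁ A B ↔ Covers T₂ A B) : T₁ = T₂ := by
  have key : ∀ T₁ T₂ : Finset R.Domino, (∀ A B, Covers T₁ A B ↔ Covers T₂ A B) → T₁ ⊆ T₂ := by
    rintro T₁ T₂ h ⟨d, hd⟩ hd1
    induction d using Sym2.ind with
    | _ x y =>
      obtain ⟨d', hd', he⟩ := covers_coe_iff.mp ((h x.1 y.1).mp ⟨_, hd1, rfl⟩)
      rwa [show (⟨s(x, y), hd⟩ : R.Domino) = d' from Subtype.ext he.symm]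
  exact (key _ _ h).antisymm (key _ _ fun A B => (h A B).symm)

open Classical in
/-- The indicator function of the dominoes in `T`. -/
noncomputable def ind (T : Finset R.Domino) (A B : ℤ × ℤ) : ℤ := if Covers T A B then 1 else 0

theorem ind_swap (A B : ℤ × ℤ) : ind T A B = ind T B A := by
  unfold ind
  congr 1
  exact propext ⟨Covers.symm, Covers.symm⟩

theorem ind_nonneg (A B : ℤ × ℤ) : 0 ≤ ind T A B := by
  unfold ind
  split_ifs <;> simp

theorem ind_le_one (A B : ℤ × ℤ) : ind T A B ≤ 1 := by
  unfold ind
  split_ifs <;> simp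

theorem ind_eq_one_iff {A B : ℤ × ℤ} : ind T A B = 1 ↔ Covers T A B := by
  unfold ind
  split_ifs with h <;> simp [h]

theorem covers_iff_of_ind_eq {A B : ℤ × ℤ} (h : ind T₁ A B = ind T₂ A B) :
    Covers T₁ A B ↔ Covers T₂ A B := by
  rw [← ind_eq_one_iff, ← ind_eq_one_iff, h]

/-! ### Chessboard colouring and alternating cycles -/

/-- The colour of a square in the chessboard colouring. -/
def color (A : ℤ × ℤ) : ℤ := if (A.1 + A.2) % 2 = 0 then 1 else -1

theorem color_eq (A : ℤ × ℤ) :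
    (color A = 1 ∧ (A.1 + A.2) % 2 = 0) ∨ (color A = -1 ∧ (A.1 + A.2) % 2 = 1) := by
  unfold color
  split_ifs <;> omega

theorem _root_.LatticeAdj.color_eq_neg {A B : ℤ × ℤ} (h : LatticeAdj A B) : color B = -color A := by
  have := color_eq A
  have := color_eq B
  rcases h.cases with h | h | h | h <;> omega

/-- The square that shares a domino of the tiling `T` with a given square. -/
noncomputable def IsTiling.partner (hT : R.IsTiling T) (A : R) : R :=
  (isTiling_iff.mp hT A).choose

theorem IsTiling.covers_iff_partner (hT : R.IsTiling T) (A B : R) :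
    Covers T A.1 B.1 ↔ hT.partner A = B := by
  have h := (isTiling_iff.mp hT A).choose_spec
  constructor
  · intro hB
    exact (h.2 B hB).symm
  · rintro rfl
    exact h.1

theorem IsTiling.covers_partner (hT : R.IsTiling T) (A : R) : Covers T A.1 (hT.partner A).1 :=
  (hT.covers_iff_partner _ _).mpr rfl

theorem IsTiling.partner_partner (hT : R.IsTiling T) (A : R) : hT.partner (hT.partner A) = A := by
  rw [← hT.covers_iff_partner]
  exact (hT.covers_partner A).symm

/-- The permutation that moves a square along its domino in the first tiling when the square is
black and along its domino in the second tiling when it is white. -/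
noncomputable def alternatingPerm (h₁ : R.IsTiling T₁) (h₂ : R.IsTiling T₂) : Equiv.Perm R where
  toFun A := if color A.1 = 1 then h₁.partner A else h₂.partner A
  invFun A := if color A.1 = 1 then h₂.partner A else h₁.partner A
  left_inv A := by
    have e1 := (h₁.covers_partner A).adj.color_eq_neg
    have e2 := (h₂.covers_partner A).adj.color_eq_neg
    rcases color_eq A.1 with ⟨h, -⟩ | ⟨h, -⟩ <;> simp [h, e1, e2, IsTiling.partner_partner]
  right_inv A := by
    have e1 := (h₁.covers_partner A).adj.color_eq_neg
    have e2 := (h₂.covers_partner A).adj.color_eq_neg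
    rcases color_eq A.1 with ⟨h, -⟩ | ⟨h, -⟩ <;> simp [h, e1, e2, IsTiling.partner_partner]

theorem alternatingPerm_eq (h₁ : R.IsTiling T₁) (h₂ : R.IsTiling T₂) (A : R) :
    alternatingPerm h₁ h₂ A = if color A.1 = 1 then h₁.partner A else h₂.partner A := rfl

theorem adj_alternatingPerm (h₁ : R.IsTiling T₁) (h₂ : R.IsTiling T₂) (A : R) :
    LatticeAdj A.1 (alternatingPerm h₁ h₂ A).1 := by
  rw [alternatingPerm_eq]
  split_ifs
  · exact (h₁.covers_partner A).adj
  · exact (h₂.covers_partner A).adj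

open Classical in
theorem sum_ite_alternatingPerm (h₁ : R.IsTiling T₁) (h₂ : R.IsTiling T₂) {A B : ℤ × ℤ} :
    (∑ C : R, if C.1 = A ∧ (alternatingPerm h₁ h₂ C).1 = B then (1 : ℤ) else 0) =
      if color A = 1 then ind T₁ A B else ind T₂ A B := by
  by_cases hA : A ∈ R
  · rw [Finset.sum_eq_single ⟨A, hA⟩]
    · have key : ((alternatingPerm h₁ h₂ ⟨A, hA⟩).1 = B) ↔
          if color A = 1 then Covers T₁ A B else Covers T₂ A B := by
        rw [alternatingPerm_eq]
        simp only
        split_ifs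
        · constructor
          · rintro rfl
            exact h₁.covers_partner ⟨A, hA⟩
          · intro h
            obtain ⟨A', B', rfl, rfl⟩ := h.exists_coe
            exact congrArg _ ((h₁.covers_iff_partner _ _).mp h)
        · constructor
          · rintro rfl
            exact h₂.covers_partner ⟨A, hA⟩
          · intro h
            obtain ⟨A', B', rfl, rfl⟩ := h.exists_coe
            exact congrArg _ ((h₂.covers_iff_partner _ _).mp h)
      simp only [true_and, key, ind]
      split_ifs <;> rfl
    · intro C _ hC
      rw [if_neg]
      rintro ⟨h, -⟩
      exact hC (Subtype.ext h)
    · simp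
  · have hn : ∀ T : Finset R.Domino, ind T A B = 0 := by
      intro T
      unfold ind
      rw [if_neg]
      intro h
      obtain ⟨A', B', rfl, rfl⟩ := h.exists_coe
      exact hA A'.2
    rw [hn, hn, ite_self]
    apply Finset.sum_eq_zero
    intro C _
    rw [if_neg]
    rintro ⟨rfl, -⟩
    exact hA C.2

/-- A domino is traversed from its black end if it is in `T₁` and from its white end if it is in
`T₂`, so the net flow from black to white is the difference of the indicators. -/
theorem sum_flow_alternatingPerm (h₁ : R.IsTiling T₁) (h₂ : R.IsTiling T₂) {A B : ℤ × ℤ}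
    (hAB : LatticeAdj A B) :
    (∑ C : R, ((if C.1 = A ∧ (alternatingPerm h₁ h₂ C).1 = B then (1 : ℤ) else 0) -
      if C.1 = B ∧ (alternatingPerm h₁ h₂ C).1 = A then 1 else 0)) =
      color A * (ind T₁ A B - ind T₂ A B) := by
  classical
  have e := hAB.color_eq_neg
  rw [Finset.sum_sub_distrib]
  convert (congrArg₂ (· - ·) (sum_ite_alternatingPerm h₁ h₂ (A := A) (B := B))
    (sum_ite_alternatingPerm h₁ h₂ (A := B) (B := A))) using 1
  rw [e, ind_swap B A, ind_swap B A]
  rcases color_eq A with ⟨h, -⟩ | ⟨h, -⟩ <;> simp [h]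

end CubiculatedRegion

/-- A function on a finite type has sum zero if its sum along each cycle of a permutation is
zero. -/
theorem sum_eq_zero_of_sum_cycle_eq_zero {α : Type*} [Fintype α] (τ : Equiv.Perm α) (g : α → ℤ)
    (h : ∀ a, ∑ k ∈ Finset.range (Function.minimalPeriod τ a), g (τ^[k] a) = 0) :
    ∑ a, g a = 0 := by
  -- Averaging over the iterates of `τ`: its order is a multiple of every cycle length, so each
  -- orbit sum of that length vanishes, while each iterate merely permutes the terms of the total.
  have hM : 0 < orderOf τ := orderOf_pos τ
  have key : ∀ a, ∑ k ∈ Finset.range (orderOf τ), g (τ^[k] a) = 0 := by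
    intro a
    have hp : Function.IsPeriodicPt τ (orderOf τ) a := by
      change τ^[orderOf τ] a = a
      rw [Equiv.Perm.iterate_eq_pow, pow_orderOf_eq_one, Equiv.Perm.one_apply]
    obtain ⟨m, hm⟩ := hp.minimalPeriod_dvd
    rw [hm]
    clear hm hp
    induction m with
    | zero => simp
    | succ m ih =>
      rw [Nat.mul_succ, Finset.sum_range_add, ih, zero_add, ← h a]
      refine Finset.sum_congr rfl fun k _ => ?_
      rw [add_comm, Function.iterate_add_apply]
      congr 2
      exact ((Function.isPeriodicPt_minimalPeriod τ a).mul_const m)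
  have hsum : ∀ k : ℕ, ∑ a, g (τ^[k] a) = ∑ a, g a := by
    intro k
    simp_rw [Equiv.Perm.iterate_eq_pow]
    exact Equiv.sum_comp (τ ^ k) g
  have : ∑ k ∈ Finset.range (orderOf τ), ∑ a, g (τ^[k] a) = 0 := by
    rw [Finset.sum_comm]
    exact Finset.sum_eq_zero fun a _ => key a
  simp_rw [hsum] at this
  rw [Finset.sum_const, Finset.card_range, nsmul_eq_mul, mul_eq_zero] at this
  rcases this with h | h
  · norm_cast at h
    omega
  · exact h

/-- The two rays differ by a unit segment, crossed only by the steps between `(x, y)` and `(x + 1,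
y)`. -/
theorem crossing_sub_crossing_vertical {A B : ℤ × ℤ} (hAB : LatticeAdj A B) (x y : ℤ) :
    crossing (x, y - 1) A B - crossing (x, y) A B =
      (if A = (x, y) ∧ B = (x + 1, y) then 1 else 0) -
        (if B = (x, y) ∧ A = (x + 1, y) then 1 else 0) := by
  obtain ⟨a, b⟩ := A
  obtain ⟨c, d⟩ := B
  simp only [crossing, Prod.mk.injEq]
  rcases hAB.cases with h | h | h | h <;> clear hAB <;> simp only at h <;>
    obtain ⟨rfl, rfl⟩ := h <;> split_ifs <;> omega

/-- Conservation law for the half column of points with abscissa `x + 1` above level `y`, entered or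
left through its two sides or its bottom. The last bracket is a coboundary and disappears on summing
over a permutation. -/
theorem crossing_sub_crossing_horizontal {A B : ℤ × ℤ} (hAB : LatticeAdj A B) (x y : ℤ) :
    crossing (x + 1, y) A B - crossing (x, y) A B =
      (if A = (x + 1, y) ∧ B = (x + 1, y + 1) then 1 else 0) -
        (if B = (x + 1, y) ∧ A = (x + 1, y + 1) then 1 else 0) +
      ((if A.1 = x + 1 ∧ y < A.2 then 1 else 0) - (if B.1 = x + 1 ∧ y < B.2 then 1 else 0)) := by
  obtain ⟨a, b⟩ := A
  obtain ⟨c, d⟩ := B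
  simp only [crossing, Prod.mk.injEq]
  rcases hAB.cases with h | h | h | h <;> clear hAB <;> simp only at h <;>
    obtain ⟨rfl, rfl⟩ := h <;> split_ifs <;> omega

/-! ### The stream function of two tilings -/

namespace CubiculatedRegion

variable {R : CubiculatedRegion} {T₁ T₂ : Finset R.Domino}

/-- `D` is a stream function, vanishing outside of the interior of the region, of the difference of
the flows of two sets of dominoes. -/
structure IsStream (T₁ T₂ : Finset R.Domino) (D : ℤ × ℤ → ℤ) : Prop where
  vertical : ∀ i j, D (i, j) - D (i, j + 1) =
    color (i - 1, j) * (ind T₁ (i - 1, j) (i, j) - ind T₂ (i - 1, j) (i, j))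
  horizontal : ∀ i j, D (i + 1, j) - D (i, j) =
    color (i, j - 1) * (ind T₁ (i, j - 1) (i, j) - ind T₂ (i, j - 1) (i, j))
  eq_zero : ∀ w, ¬ R.IsInterior w → D w = 0

theorem IsSimplyConnected.exists_isStream (hR : R.IsSimplyConnected) (h₁ : R.IsTiling T₁)
    (h₂ : R.IsTiling T₂) : ∃ D, IsStream T₁ T₂ D := by
  set τ := alternatingPerm h₁ h₂ with hτ
  refine ⟨fun w => ∑ A : R, crossing (w.1 - 1, w.2 - 1) A.1 (τ A).1, ?_, ?_, ?_⟩
  · intro i j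
    have hadj : LatticeAdj (i - 1, j) (i, j) := by unfold LatticeAdj; simp only; omega
    rw [← sum_flow_alternatingPerm h₁ h₂ hadj, ← Finset.sum_sub_distrib]
    refine Finset.sum_congr rfl fun A _ => ?_
    have hA := adj_alternatingPerm h₁ h₂ A
    rw [← hτ] at hA ⊢
    have key := crossing_sub_crossing_vertical hA (i - 1) j
    simp only [sub_add_cancel, add_sub_cancel_right, and_comm] at key ⊢
    exact key
  · intro i j
    have hadj : LatticeAdj (i, j - 1) (i, j) := by unfold LatticeAdj; simp only; omega
    rw [← sum_flow_alternatingPerm h₁ h₂ hadj, ← Finset.sum_sub_distrib]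
    let g : R → ℤ := fun A => if A.1.1 = i ∧ j ≤ A.1.2 then 1 else 0
    have hg : ∑ A, (g A - g (τ A)) = 0 := by
      rw [Finset.sum_sub_distrib, Equiv.sum_comp τ g, sub_self]
    refine Eq.trans ?_ ((congrArg (_ + ·) hg).trans (add_zero _))
    rw [← Finset.sum_add_distrib]
    refine Finset.sum_congr rfl fun A _ => ?_
    have hA := adj_alternatingPerm h₁ h₂ A
    rw [← hτ] at hA ⊢
    have key := crossing_sub_crossing_horizontal hA (i - 1) (j - 1)
    simp only [sub_add_cancel, add_sub_cancel_right, and_comm, Int.sub_one_lt_iff, g] at key ⊢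
    exact key
  · intro w hw
    apply sum_eq_zero_of_sum_cycle_eq_zero τ
    intro A
    set n := Function.minimalPeriod τ A with hn
    have hper : τ^[n] A = A := Function.iterate_minimalPeriod
    have hsucc : ∀ k, τ (τ^[k] A) = τ^[k + 1] A := fun k => (Function.iterate_succ_apply' _ _ _).symm
    simp_rw [hsucc]
    -- Only cycles of length at least three are polygons. A cycle of length two is a domino common
    -- to both tilings, and its two crossings cancel.
    rcases (show n = 0 ∨ n = 1 ∨ n = 2 ∨ 3 ≤ n by omega) with h | h | h | h
    · simp [h]
    · rw [h] at hper ⊢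
      rw [Finset.sum_range_one, zero_add, hper]
      exact crossing_self _ _
    · rw [h] at hper ⊢
      rw [Finset.sum_range_succ, Finset.sum_range_one, hper, crossing_swap]
      simp
    · apply hR.sum_crossing_squares (c := fun k => (τ^[k] A).1) h _ _ _ _ hw
      · simp [hper]
      · intro k hk l hl hkl
        exact Function.iterate_injOn_Iio_minimalPeriod hk hl (Subtype.ext hkl)
      · intro k _
        rw [← hsucc]
        exact adj_alternatingPerm h₁ h₂ _
      · exact fun k => (τ^[k] A).2

theorem IsStream.swap {D : ℤ × ℤ → ℤ} (h : IsStream T₁ T₂ D) : IsStream T₂ T₁ (-D) where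
  vertical i j := by
    have := h.vertical i j
    simp only [Pi.neg_apply]
    linarith
  horizontal i j := by
    have := h.horizontal i j
    simp only [Pi.neg_apply]
    linarith
  eq_zero w hw := by simp [h.eq_zero w hw]

theorem IsStream.eq_of_eq_zero {D : ℤ × ℤ → ℤ} (h : IsStream T₁ T₂ D) (h0 : ∀ w, D w = 0) :
    T₁ = T₂ := by
  have hv : ∀ i j, ind T₁ (i - 1, j) (i, j) = ind T₂ (i - 1, j) (i, j) := by
    intro i j
    have := h.vertical i j
    rw [h0, h0] at this
    rcases color_eq (i - 1, j) with ⟨e, -⟩ | ⟨e, -⟩ <;> rw [e] at this <;> linarith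
  have hh : ∀ i j, ind T₁ (i, j - 1) (i, j) = ind T₂ (i, j - 1) (i, j) := by
    intro i j
    have := h.horizontal i j
    rw [h0, h0] at this
    rcases color_eq (i, j - 1) with ⟨e, -⟩ | ⟨e, -⟩ <;> rw [e] at this <;> linarith
  have key : ∀ A B, LatticeAdj A B → ind T₁ A B = ind T₂ A B := by
    rintro ⟨x, y⟩ ⟨z, w⟩ hAB
    rcases hAB.cases with ⟨e1, e2⟩ | ⟨e1, e2⟩ | ⟨e1, e2⟩ | ⟨e1, e2⟩ <;> simp only at e1 e2 <;>
      subst e1 e2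
    · simpa using hv (x + 1) w
    · rw [ind_swap, hv, ind_swap]
    · simpa using hh z (y + 1)
    · rw [ind_swap, hh, ind_swap]
  apply eq_of_covers_iff
  intro A B
  constructor
  · intro hA
    exact (covers_iff_of_ind_eq (key A B hA.adj)).mp hA
  · intro hA
    exact (covers_iff_of_ind_eq (key A B hA.adj)).mpr hA

end CubiculatedRegion

/-! ### Discrete integration -/

theorem exists_forward_difference_eq (f : ℤ → ℤ) (M : ℤ) :
    ∃ F : ℤ → ℤ, ∀ j, M ≤ j → F (j + 1) - F j = f j := by
  refine ⟨fun j => ∑ m ∈ Finset.range (j - M).toNat, f (M + m), fun j hj => ?_⟩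
  simp only
  rw [show (j + 1 - M).toNat = (j - M).toNat + 1 by omega, Finset.sum_range_succ,
    add_sub_cancel_left]
  congr 1
  omega

/-- Discrete integration of a cochain on the edges of a lattice box: up to the windings around the
unit squares, weighted by the coboundary `δ`, the cochain is the difference of a function. -/
theorem exists_potential (a b δ : ℤ × ℤ → ℤ)
    (hδ : ∀ i j, δ (i, j) = b (i, j) + a (i + 1, j) - b (i, j + 1) - a (i, j)) (M N : ℤ) :
    ∃ H : ℤ × ℤ → ℤ, ∀ i j, M ≤ i → i < N → M ≤ j → j < N →
      H (i, j + 1) - H (i, j) = a (i, j) ∧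
      H (i + 1, j) - H (i, j) = b (i, j) +
        ∑ s ∈ Finset.Ico M N ×ˢ Finset.Ico M N, δ s * crossing s (i, j) (i + 1, j) := by
  choose F hF using fun i => exists_forward_difference_eq (fun j => a (i, j)) M
  obtain ⟨G, hG⟩ := exists_forward_difference_eq (fun i => b (i, M)) M
  -- Integrate `b` along the bottom row of the box, then `a` up the column. The error in a
  -- horizontal step is `δ` summed over the squares below it, whose rays are exactly those that
  -- cross it.
  refine ⟨fun w => G w.1 + F w.1 w.2 - F w.1 M, fun i j hi hiN hj hjN => ⟨?_, ?_⟩⟩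
  · have := hF i j hj
    simp only
    linarith
  · have hcr : ∀ j, ∑ s ∈ Finset.Ico M N ×ˢ Finset.Ico M N, δ s * crossing s (i, j) (i + 1, j) =
        ∑ s ∈ Finset.Ico M N ×ˢ Finset.Ico M N, if s.1 = i ∧ s.2 < j then δ s else 0 := by
      intro j
      refine Finset.sum_congr rfl fun s _ => ?_
      unfold crossing
      by_cases h : s.1 = i ∧ s.2 < j
      · rw [if_pos h, if_pos (by simp only; omega), if_neg (by simp only; omega)]
        ring
      · rw [if_neg h, if_neg (by simp only; omega), if_neg (by simp only; omega)]
        ring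
    rw [hcr]
    simp only
    induction j, hj using Int.leInduction with
    | base =>
      rw [Finset.sum_eq_zero]
      · have := hG i hi
        linarith
      · rintro s hs
        rw [Finset.mem_product, Finset.mem_Ico, Finset.mem_Ico] at hs
        rw [if_neg]
        omega
    | succ j hj ih =>
      have hs : (∑ s ∈ Finset.Ico M N ×ˢ Finset.Ico M N, if s.1 = i ∧ s.2 < j + 1 then δ s else 0) =
          (∑ s ∈ Finset.Ico M N ×ˢ Finset.Ico M N, if s.1 = i ∧ s.2 < j then δ s else 0) +
            δ (i, j) := by
        have hmem : (i, j) ∈ Finset.Ico M N ×ˢ Finset.Ico M N := by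
          rw [Finset.mem_product, Finset.mem_Ico, Finset.mem_Ico]
          simp only
          omega
        have : δ (i, j) = ∑ s ∈ Finset.Ico M N ×ˢ Finset.Ico M N, if (i, j) = s then δ s else 0 := by
          rw [Finset.sum_ite_eq, if_pos hmem]
        rw [this, ← Finset.sum_add_distrib]
        refine Finset.sum_congr rfl fun s _ => ?_
        simp only [Prod.ext_iff]
        split_ifs <;> omega
      have h1 := hF i j hj
      have h2 := hF (i + 1) j hj
      have h3 := hδ i j
      have h4 := ih (by omega)
      rw [hs]
      linarith

/-! ### Height functions -/

namespace CubiculatedRegion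

variable {R : CubiculatedRegion} {T T₁ T₂ : Finset R.Domino}

theorem IsTiling.sum_ind_eq_one (hT : R.IsTiling T) {i j : ℤ} (h : (i, j) ∈ R) :
    ind T (i - 1, j) (i, j) + ind T (i, j) (i + 1, j) + ind T (i, j - 1) (i, j) +
      ind T (i, j) (i, j + 1) = 1 := by
  have hadj := (hT.covers_partner ⟨(i, j), h⟩).adj
  set B := (hT.partner ⟨(i, j), h⟩).1 with hB
  have key : ∀ C, ind T (i, j) C = if C = B then 1 else 0 := by
    intro C
    unfold ind
    congr 1
    refine propext ⟨fun hC => ?_, ?_⟩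
    · obtain ⟨A', C', hA, rfl⟩ := hC.exists_coe
      obtain rfl : A' = ⟨(i, j), h⟩ := Subtype.ext hA
      rw [hB, (hT.covers_iff_partner _ _).mp hC]
    · rintro rfl
      exact hT.covers_partner ⟨(i, j), h⟩
  rw [ind_swap (i - 1, j), ind_swap (i, j - 1), key, key, key, key]
  simp only [Prod.ext_iff]
  rcases hadj.cases with h | h | h | h <;> simp only at h <;> split_ifs <;> omega

/-- The increment of the height function of `T` along the upward step from `w`. -/
noncomputable def stepUp (T : Finset R.Domino) (w : ℤ × ℤ) : ℤ :=
  color (w.1 - 1, w.2) * (1 - 4 * ind T (w.1 - 1, w.2) w)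

/-- The increment of the height function of `T` along the step to the right from `w`. -/
noncomputable def stepRight (T : Finset R.Domino) (w : ℤ × ℤ) : ℤ :=
  color w * (1 - 4 * ind T (w.1, w.2 - 1) w)

/-- The increment of the height function of `T` along the step from `A` to `B`. -/
noncomputable def heightStep (T : Finset R.Domino) (A B : ℤ × ℤ) : ℤ :=
  if A.1 = B.1 then (if A.2 < B.2 then stepUp T A else -stepUp T B)
  else (if A.1 < B.1 then stepRight T A else -stepRight T B)

theorem heightStep_up (x y : ℤ) : heightStep T (x, y) (x, y + 1) = stepUp T (x, y) := by
  unfold heightStep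
  rw [if_pos rfl, if_pos (lt_add_one y)]

theorem heightStep_down (x y : ℤ) : heightStep T (x, y) (x, y - 1) = -stepUp T (x, y - 1) := by
  unfold heightStep
  rw [if_pos rfl, if_neg (by simp)]

theorem heightStep_right (x y : ℤ) : heightStep T (x, y) (x + 1, y) = stepRight T (x, y) := by
  unfold heightStep
  rw [if_neg (by simp), if_pos (lt_add_one x)]

theorem heightStep_left (x y : ℤ) : heightStep T (x, y) (x - 1, y) = -stepRight T (x - 1, y) := by
  unfold heightStep
  rw [if_neg (by simp only; omega), if_neg (by simp)]

theorem heightStep_swap {A B : ℤ × ℤ} (h : LatticeAdj A B) :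
    heightStep T B A = -heightStep T A B := by
  unfold heightStep
  rcases h.cases with h | h | h | h <;> split_ifs <;> omega

theorem heightStep_le (A B : ℤ × ℤ) : heightStep T A B ≤ 3 := by
  have hu : ∀ w, stepUp T w ≤ 3 ∧ -3 ≤ stepUp T w := by
    intro w
    have h1 := ind_nonneg (T := T) (w.1 - 1, w.2) w
    have h2 := ind_le_one (T := T) (w.1 - 1, w.2) w
    unfold stepUp
    rcases color_eq (w.1 - 1, w.2) with ⟨e, -⟩ | ⟨e, -⟩ <;> rw [e] <;> constructor <;> linarith
  have hr : ∀ w, stepRight T w ≤ 3 ∧ -3 ≤ stepRight T w := by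
    intro w
    have h1 := ind_nonneg (T := T) (w.1, w.2 - 1) w
    have h2 := ind_le_one (T := T) (w.1, w.2 - 1) w
    unfold stepRight
    rcases color_eq w with ⟨e, -⟩ | ⟨e, -⟩ <;> rw [e] <;> constructor <;> linarith
  have := hu A
  have := hu B
  have := hr A
  have := hr B
  unfold heightStep
  split_ifs <;> omega

/-- A step contributes the colour of the square on its left, times `-3` if a domino crosses it. The
part independent of the tiling cancels, leaving four times an increment of `D`. -/
theorem IsStream.heightStep_sub {D : ℤ × ℤ → ℤ} (h : IsStream T₁ T₂ D) {A B : ℤ × ℤ}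
    (hAB : LatticeAdj A B) :
    heightStep T₁ A B - heightStep T₂ A B = 4 * (D B - D A) := by
  have hu : ∀ i j, stepUp T₁ (i, j) - stepUp T₂ (i, j) = 4 * (D (i, j + 1) - D (i, j)) := by
    intro i j
    have := h.vertical i j
    unfold stepUp
    linarith
  have hr : ∀ i j, stepRight T₁ (i, j) - stepRight T₂ (i, j) = 4 * (D (i + 1, j) - D (i, j)) := by
    intro i j
    have hadj : LatticeAdj (i, j - 1) (i, j) := by unfold LatticeAdj; simp only; omega
    have e := hadj.color_eq_neg
    have := h.horizontal i j
    unfold stepRight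
    rw [e]
    linarith
  obtain ⟨x, y⟩ := A
  obtain ⟨z, w⟩ := B
  rcases hAB.cases with ⟨e1, e2⟩ | ⟨e1, e2⟩ | ⟨e1, e2⟩ | ⟨e1, e2⟩ <;> simp only at e1 e2 <;>
    subst e1 e2
  · rw [heightStep_right, heightStep_right, hr]
  · have := hr (x - 1) w
    rw [sub_add_cancel] at this
    rw [heightStep_left, heightStep_left]
    linarith
  · rw [heightStep_up, heightStep_up, hu]
  · have := hu z (y - 1)
    rw [sub_add_cancel] at this
    rw [heightStep_down, heightStep_down]
    linarith

/-- Discrete Stokes formula: up to sign, the sum is that of the circulations `δ s` weighted by the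
winding of the polygon about `s`. For `s ∈ R` exactly one side is crossed by a domino, so `δ s` is a
multiple of `4 - 4`; for `s ∉ R` the winding vanishes. -/
theorem IsSimplyConnected.sum_heightStep_eq_zero (hR : R.IsSimplyConnected) (hT : R.IsTiling T)
    {n : ℕ} (hn : 3 ≤ n) {c : ℕ → ℤ × ℤ} (hc : c n = c 0) (hinj : Set.InjOn c (Set.Iio n))
    (hadj : ∀ k < n, LatticeAdj (c k) (c (k + 1))) (hint : ∀ k, R.IsInterior (c k)) :
    ∑ k ∈ Finset.range n, heightStep T (c k) (c (k + 1)) = 0 := by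
  obtain ⟨M, N, hMN⟩ : ∃ M N : ℤ, ∀ w, R.IsInterior w → M ≤ w.1 ∧ w.1 < N ∧ M ≤ w.2 ∧ w.2 < N := by
    refine ⟨-(∑ w ∈ R, (|w.1| + |w.2|)), (∑ w ∈ R, (|w.1| + |w.2|)) + 1, fun w hw => ?_⟩
    have := Finset.single_le_sum (f := fun w : ℤ × ℤ => |w.1| + |w.2|)
      (fun w _ => add_nonneg (abs_nonneg _) (abs_nonneg _)) hw.1
    simp only at this
    have := abs_le.mp (show |w.1| ≤ |w.1| from le_rfl)
    have := abs_le.mp (show |w.2| ≤ |w.2| from le_rfl)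
    have := abs_nonneg w.1
    have := abs_nonneg w.2
    omega
  set δ : ℤ × ℤ → ℤ := fun s => stepRight T s + stepUp T (s.1 + 1, s.2) -
    stepRight T (s.1, s.2 + 1) - stepUp T s with hδ
  obtain ⟨H, hH⟩ := exists_potential (stepUp T) (stepRight T) δ (fun _ _ => rfl) M N
  have hδ0 : ∀ s ∈ R, δ s = 0 := by
    rintro ⟨i, j⟩ hs
    have h1 := hT.sum_ind_eq_one hs
    have e1 := (show LatticeAdj (i, j) (i, j + 1) by
      unfold LatticeAdj; simp only; omega).color_eq_neg
    have e2 := (show LatticeAdj (i, j) (i - 1, j) by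
      unfold LatticeAdj; simp only; omega).color_eq_neg
    simp only [hδ, stepRight, stepUp, add_sub_cancel_right, e1, e2]
    linear_combination (-4 * color (i, j)) * h1
  have hstep : ∀ k < n, heightStep T (c k) (c (k + 1)) = (H (c (k + 1)) - H (c k)) -
      ∑ s ∈ Finset.Ico M N ×ˢ Finset.Ico M N, δ s * crossing s (c k) (c (k + 1)) := by
    intro k hk
    have hA := hMN _ (hint k)
    have hB := hMN _ (hint (k + 1))
    have hAB := hadj k hk
    generalize c k = A at hA hAB ⊢
    generalize c (k + 1) = B at hB hAB ⊢
    obtain ⟨x, y⟩ := A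
    obtain ⟨z, w⟩ := B
    have hvert : ∀ s, crossing s (z, y) (z, w) = 0 := by
      intro s
      unfold crossing
      rw [if_neg, if_neg] <;> omega
    simp only at hA hB
    rcases hAB.cases with ⟨e1, e2⟩ | ⟨e1, e2⟩ | ⟨e1, e2⟩ | ⟨e1, e2⟩ <;> simp only at e1 e2 <;>
      subst e1 e2
    · have := (hH x w (by omega) (by omega) (by omega) (by omega)).2
      rw [heightStep_right]
      linarith
    · have := (hH (x - 1) w (by omega) (by omega) (by omega) (by omega)).2
      simp only [sub_add_cancel, crossing_swap _ (x, w), mul_neg, Finset.sum_neg_distrib] at this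
      rw [heightStep_left]
      linarith
    · have := (hH z y (by omega) (by omega) (by omega) (by omega)).1
      simp only [hvert, mul_zero, Finset.sum_const_zero]
      rw [heightStep_up]
      linarith
    · have := (hH z (y - 1) (by omega) (by omega) (by omega) (by omega)).1
      simp only [hvert, mul_zero, Finset.sum_const_zero]
      rw [sub_add_cancel] at this
      rw [heightStep_down]
      linarith
  rw [Finset.sum_congr rfl (fun k hk => hstep k (Finset.mem_range.mp hk)), Finset.sum_sub_distrib,
    Finset.sum_range_sub (fun k => H (c k)), hc, sub_self, zero_sub, neg_eq_zero, Finset.sum_comm]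
  refine Finset.sum_eq_zero fun s _ => ?_
  rw [← Finset.mul_sum]
  by_cases hs : s ∈ R
  · rw [hδ0 s hs, zero_mul]
  · rw [hR.sum_crossing_vertices hn hc hinj hadj hint hs, mul_zero]

/-! ### Local maxima and flips -/

/-- In a finite set of interior points that is closed under going uphill there is a point from which
no step goes uphill. -/
theorem IsSimplyConnected.exists_local_max (hR : R.IsSimplyConnected) (hT : R.IsTiling T)
    {P : Set (ℤ × ℤ)} (hP : P.Nonempty) (hint : ∀ v ∈ P, R.IsInterior v)
    (hup : ∀ v ∈ P, ∀ u, LatticeAdj v u → 0 < heightStep T v u → u ∈ P) :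
    ∃ v ∈ P, ∀ u, LatticeAdj v u → heightStep T v u ≤ 0 := by
  by_contra! hcon
  choose! f hf using hcon
  have hfin : Finite P := (R.finite_toSet.subset fun v hv => (hint v hv).1).to_subtype
  -- Uphill steps define a self-map of a finite set. It has a periodic point, around whose orbit the
  -- height would increase strictly.
  let g : P → P := fun v => ⟨f v, hup v v.2 _ (hf v v.2).1 (hf v v.2).2⟩
  obtain ⟨y, hy⟩ : ∃ y, y ∈ Function.periodicPts g := by
    obtain ⟨x, hx⟩ := hP
    obtain ⟨k, l, hkl, he⟩ :=
      Finite.exists_ne_map_eq_of_infinite fun m : ℕ => g^[m] (⟨x, hx⟩ : P)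
    have key : ∀ k l, k < l → g^[k] (⟨x, hx⟩ : P) = g^[l] ⟨x, hx⟩ →
        g^[k] (⟨x, hx⟩ : P) ∈ Function.periodicPts g := by
      intro k l hkl he
      refine Function.mk_mem_periodicPts (n := l - k) (by omega) ?_
      change g^[l - k] _ = _
      rw [← Function.iterate_add_apply, Nat.sub_add_cancel hkl.le, he]
    rcases hkl.lt_or_gt with h | h
    · exact ⟨_, key k l h he⟩
    · exact ⟨_, key l k h he.symm⟩
  set n := Function.minimalPeriod g y with hn
  have hn0 : 0 < n := Function.minimalPeriod_pos_of_mem_periodicPts hy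
  have hper : g^[n] y = y := Function.iterate_minimalPeriod
  have hadj : ∀ v : P, LatticeAdj v.1 (g v).1 := fun v => (hf v v.2).1
  have hpos : ∀ v : P, 0 < heightStep T v.1 (g v).1 := fun v => (hf v v.2).2
  have hsucc : ∀ k, g^[k + 1] y = g (g^[k] y) := fun k => Function.iterate_succ_apply' _ _ _
  have hn3 : 3 ≤ n := by
    by_contra! hlt
    rcases (show n = 1 ∨ n = 2 by omega) with h | h <;> rw [h] at hper
    · have := hadj y
      rw [show g y = y from hper] at this
      simp [LatticeAdj] at this
    · have h1 := hpos y
      have h2 := hpos (g y)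
      rw [show g (g y) = y from hper, heightStep_swap (hadj y)] at h2
      omega
  have hsum := hR.sum_heightStep_eq_zero hT (c := fun k => (g^[k] y).1) hn3 (by simp [hper])
    (fun k hk l hl hkl => Function.iterate_injOn_Iio_minimalPeriod hk hl (Subtype.ext hkl))
    (fun k _ => by rw [hsucc]; exact hadj _) (fun k => hint _ (g^[k] y).2)
  refine hsum.not_gt (Finset.sum_pos (fun k _ => ?_) ⟨0, Finset.mem_range.mpr hn0⟩)
  rw [hsucc]
  exact hpos _

/-- At a local maximum of the height function there is a pair of parallel dominoes. -/
theorem parallel_of_local_max {i j : ℤ}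
    (h : ∀ u, LatticeAdj (i, j) u → heightStep T (i, j) u ≤ 0) :
    (color (i - 1, j) = 1 ∧ Covers T (i - 1, j - 1) (i, j - 1) ∧ Covers T (i - 1, j) (i, j)) ∨
    (color (i - 1, j) = -1 ∧ Covers T (i - 1, j - 1) (i - 1, j) ∧ Covers T (i, j - 1) (i, j)) := by
  -- Two opposite steps out of `(i, j)` have a black square on their left. They rise by one unless
  -- crossed by a domino, so at a local maximum both are crossed.
  have h1 := h (i, j + 1) (by unfold LatticeAdj; simp only; omega)
  have h2 := h (i, j - 1) (by unfold LatticeAdj; simp only; omega)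
  have h3 := h (i + 1, j) (by unfold LatticeAdj; simp only; omega)
  have h4 := h (i - 1, j) (by unfold LatticeAdj; simp only; omega)
  simp only [← ind_eq_one_iff]
  rw [heightStep_up] at h1
  rw [heightStep_down] at h2
  rw [heightStep_right] at h3
  rw [heightStep_left] at h4
  simp only [stepUp, stepRight] at h1 h2 h3 h4
  have e1 := (show LatticeAdj (i - 1, j) (i, j) by unfold LatticeAdj; simp only; omega).color_eq_neg
  have e2 := (show LatticeAdj (i - 1, j) (i - 1, j - 1) by
    unfold LatticeAdj; simp only; omega).color_eq_neg
  have b1 := ind_le_one (T := T) (i - 1, j) (i, j)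
  have b2 := ind_le_one (T := T) (i - 1, j - 1) (i, j - 1)
  have b3 := ind_le_one (T := T) (i, j - 1) (i, j)
  have b4 := ind_le_one (T := T) (i - 1, j - 1) (i - 1, j)
  rw [e2] at h2
  rw [e1] at h3
  rcases color_eq (i - 1, j) with ⟨e, -⟩ | ⟨e, -⟩ <;> rw [e] at h1 h2 h3 h4 ⊢ <;> omega

/-- Rotating two parallel dominoes `{a, b}` and `{d, c}` of a tiling to `{a, d}` and `{b, c}`. -/
theorem IsTiling.exists_rotate (hT : R.IsTiling T) {a b c d : R} (hab : Covers T a.1 b.1)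
    (hdc : Covers T d.1 c.1) (had : LatticeAdj a.1 d.1) (hbc : LatticeAdj b.1 c.1)
    (hac : a ≠ c) (hbd : b ≠ d) :
    ∃ D₁ D₂ T' : Finset R.Domino, R.IsTiling T' ∧
      (∀ e : R.Domino, e ∈ D₁ ↔ e.1 = s(a, b) ∨ e.1 = s(d, c)) ∧
      (∀ e : R.Domino, e ∈ D₂ ↔ e.1 = s(a, d) ∨ e.1 = s(b, c)) ∧
      (∀ (K : Type*) [Field K], R.binom K T T' = R.monom K (T \ D₁) * R.binom K D₁ D₂) ∧
      ∀ A B, ind T' A B = ind T A B -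
        (if s(A, B) = s(a.1, b.1) ∨ s(A, B) = s(d.1, c.1) then 1 else 0) +
        (if s(A, B) = s(a.1, d.1) ∨ s(A, B) = s(b.1, c.1) then 1 else 0) := by
  classical
  obtain ⟨eab, heabT, heab⟩ := covers_coe_iff.mp hab
  obtain ⟨edc, hedcT, hedc⟩ := covers_coe_iff.mp hdc
  obtain ⟨ead, head⟩ : ∃ e : R.Domino, e.1 = s(a, d) := ⟨⟨s(a, d), had⟩, rfl⟩
  obtain ⟨ebc, hebc⟩ : ∃ e : R.Domino, e.1 = s(b, c) := ⟨⟨s(b, c), hbc⟩, rfl⟩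
  have pa : hT.partner a = b := (hT.covers_iff_partner _ _).mp hab
  have pb : hT.partner b = a := (hT.covers_iff_partner _ _).mp hab.symm
  have pd : hT.partner d = c := (hT.covers_iff_partner _ _).mp hdc
  have pc : hT.partner c = d := (hT.covers_iff_partner _ _).mp hdc.symm
  have nab : a ≠ b := by rintro rfl; simpa [LatticeAdj] using hab.adj
  have ndc : d ≠ c := by rintro rfl; simpa [LatticeAdj] using hdc.adj
  have nad : a ≠ d := by rintro rfl; simp [LatticeAdj] at had
  have nbc : b ≠ c := by rintro rfl; simp [LatticeAdj] at hbc
  have hD₁ : ∀ e : R.Domino, e ∈ ({eab, edc} : Finset R.Domino) ↔ e.1 = s(a, b) ∨ e.1 = s(d, c) := by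
    intro e
    rw [Finset.mem_insert, Finset.mem_singleton, ← heab, ← hedc, Subtype.ext_iff, Subtype.ext_iff]
  have hD₂ : ∀ e : R.Domino, e ∈ ({ead, ebc} : Finset R.Domino) ↔ e.1 = s(a, d) ∨ e.1 = s(b, c) := by
    intro e
    rw [Finset.mem_insert, Finset.mem_singleton, ← head, ← hebc, Subtype.ext_iff, Subtype.ext_iff]
  have hsub : ({eab, edc} : Finset R.Domino) ⊆ T := by
    intro e he
    rw [Finset.mem_insert, Finset.mem_singleton] at he
    rcases he with rfl | rfl <;> assumption
  have hnot : ∀ e ∈ ({ead, ebc} : Finset R.Domino), e ∉ T := by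
    intro e he heT
    rcases (hD₂ e).mp he with h | h
    · have := (hT.covers_iff_partner _ _).mp (covers_coe_iff.mpr ⟨e, heT, h⟩)
      exact hbd (pa.symm.trans this)
    · have := (hT.covers_iff_partner _ _).mp (covers_coe_iff.mpr ⟨e, heT, h⟩)
      exact hac (pb.symm.trans this)
  set T' := T \ {eab, edc} ∪ {ead, ebc} with hT'
  have hmap : ∀ (e : R.Domino) (A B x y : R), e.1 = s(A, B) →
      (e.1 = s(x, y) ↔ s(A.1, B.1) = s(x.1, y.1)) := by
    intro e A B x y h
    rw [h, ← Sym2.map_mk, ← Sym2.map_mk, (Sym2.map.injective Subtype.val_injective).eq_iff]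
  have hcov : ∀ A B, Covers T' A B ↔
      (Covers T A B ∧ ¬ (s(A, B) = s(a.1, b.1) ∨ s(A, B) = s(d.1, c.1))) ∨
        (s(A, B) = s(a.1, d.1) ∨ s(A, B) = s(b.1, c.1)) := by
    intro A B
    constructor
    · intro h
      obtain ⟨A, B, rfl, rfl⟩ := h.exists_coe
      obtain ⟨e, he, heAB⟩ := covers_coe_iff.mp h
      rw [hT', Finset.mem_union, Finset.mem_sdiff, hD₁, hD₂, hmap e A B _ _ heAB,
        hmap e A B _ _ heAB, hmap e A B _ _ heAB, hmap e A B _ _ heAB] at he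
      exact he.imp_left fun h => ⟨covers_coe_iff.mpr ⟨e, h.1, heAB⟩, h.2⟩
    · rintro (⟨h, hn⟩ | h | h)
      · obtain ⟨A, B, rfl, rfl⟩ := h.exists_coe
        obtain ⟨e, he, heAB⟩ := covers_coe_iff.mp h
        refine covers_coe_iff.mpr ⟨e, ?_, heAB⟩
        rw [hT', Finset.mem_union, Finset.mem_sdiff, hD₁, hmap e A B _ _ heAB,
          hmap e A B _ _ heAB]
        exact Or.inl ⟨he, hn⟩
      · refine ⟨ead, by simp [hT'], ?_⟩
        rw [h, head, Sym2.map_mk]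
      · refine ⟨ebc, by simp [hT'], ?_⟩
        rw [h, hebc, Sym2.map_mk]
  have hcov' : ∀ A B : R, Covers T' A.1 B.1 ↔
      (hT.partner A = B ∧ ¬ (((A = a ∧ B = b) ∨ (A = b ∧ B = a)) ∨
        ((A = d ∧ B = c) ∨ (A = c ∧ B = d)))) ∨
      (((A = a ∧ B = d) ∨ (A = d ∧ B = a)) ∨ ((A = b ∧ B = c) ∨ (A = c ∧ B = b))) := by
    intro A B
    rw [hcov, hT.covers_iff_partner]
    simp only [Sym2.eq_iff, Subtype.val_inj]
  refine ⟨{eab, edc}, {ead, ebc}, T', ?_, hD₁, hD₂, ?_, ?_⟩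
  · rw [isTiling_iff]
    intro A
    simp only [hcov']
    by_cases h1 : A = a
    · exact ⟨d, by grind, by grind⟩
    by_cases h2 : A = b
    · exact ⟨c, by grind, by grind⟩
    by_cases h3 : A = c
    · exact ⟨b, by grind, by grind⟩
    by_cases h4 : A = d
    · exact ⟨a, by grind, by grind⟩
    exact ⟨hT.partner A, by grind, by grind⟩
  · intro K _
    have hdisj : Disjoint (T \ {eab, edc}) {ead, ebc} := by
      rw [Finset.disjoint_right]
      intro e he heT
      exact hnot e he (Finset.mem_sdiff.mp heT).1
    simp only [binom, monom]
    rw [hT', Finset.prod_union hdisj, ← Finset.prod_sdiff hsub, mul_sub]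
  · intro A B
    have h1 : (s(A, B) = s(a.1, b.1) ∨ s(A, B) = s(d.1, c.1)) → Covers T A B := by
      rintro (h | h)
      · exact ⟨eab, heabT, by rw [h, heab, Sym2.map_mk]⟩
      · exact ⟨edc, hedcT, by rw [h, hedc, Sym2.map_mk]⟩
    have h2 : (s(A, B) = s(a.1, d.1) ∨ s(A, B) = s(b.1, c.1)) → ¬ Covers T A B := by
      intro h hcon
      obtain ⟨A, B, rfl, rfl⟩ := hcon.exists_coe
      obtain ⟨e, he, heAB⟩ := covers_coe_iff.mp hcon
      refine hnot e ((hD₂ e).mpr ?_) he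
      rwa [hmap e A B _ _ heAB, hmap e A B _ _ heAB]
    unfold ind
    rw [if_congr (hcov A B) rfl rfl]
    split_ifs <;> first | rfl | (exfalso; tauto)

/-- `exists_rotate` does not prescribe which pair is horizontal, so both cases come from it by
exchanging `b` and `d`; the colour carries the sign. -/
theorem IsTiling.exists_flip (hT : R.IsTiling T) {i j : ℤ} (hint : R.IsInterior (i, j))
    (h : (color (i - 1, j) = 1 ∧ Covers T (i - 1, j - 1) (i, j - 1) ∧ Covers T (i - 1, j) (i, j)) ∨
      (color (i - 1, j) = -1 ∧ Covers T (i - 1, j - 1) (i - 1, j) ∧ Covers T (i, j - 1) (i, j))) :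
    ∃ T' : Finset R.Domino, R.IsTiling T' ∧
      (∀ (K : Type*) [Field K], R.binom K T T' ∈ R.flipIdeal K) ∧
      (∀ x y, ind T' (x - 1, y) (x, y) = ind T (x - 1, y) (x, y) -
        color (i - 1, j) * (if x = i ∧ (y = j ∨ y = j - 1) then 1 else 0)) ∧
      (∀ x y, ind T' (x, y - 1) (x, y) = ind T (x, y - 1) (x, y) +
        color (i - 1, j) * (if y = j ∧ (x = i ∨ x = i - 1) then 1 else 0)) := by
  obtain ⟨hc, hd, hb, ha⟩ := hint
  simp only at hc hd hb ha
  have e1 : ∀ x y : ℤ, (s((x - 1, y), (x, y)) = s((i - 1, j - 1), (i, j - 1)) ∨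
      s((x - 1, y), (x, y)) = s((i - 1, j), (i, j))) ↔ x = i ∧ (y = j ∨ y = j - 1) := by
    intro x y
    simp only [Sym2.eq_iff, Prod.mk.injEq]
    omega
  have e2 : ∀ x y : ℤ, (s((x - 1, y), (x, y)) = s((i - 1, j - 1), (i - 1, j)) ∨
      s((x - 1, y), (x, y)) = s((i, j - 1), (i, j))) ↔ False := by
    intro x y
    simp only [Sym2.eq_iff, Prod.mk.injEq, iff_false]
    omega
  have e3 : ∀ x y : ℤ, (s((x, y - 1), (x, y)) = s((i - 1, j - 1), (i, j - 1)) ∨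
      s((x, y - 1), (x, y)) = s((i - 1, j), (i, j))) ↔ False := by
    intro x y
    simp only [Sym2.eq_iff, Prod.mk.injEq, iff_false]
    omega
  have e4 : ∀ x y : ℤ, (s((x, y - 1), (x, y)) = s((i - 1, j - 1), (i - 1, j)) ∨
      s((x, y - 1), (x, y)) = s((i, j - 1), (i, j))) ↔ y = j ∧ (x = i ∨ x = i - 1) := by
    intro x y
    simp only [Sym2.eq_iff, Prod.mk.injEq]
    omega
  let a : R := ⟨_, ha⟩
  let b : R := ⟨_, hb⟩
  let c : R := ⟨_, hc⟩
  let d : R := ⟨_, hd⟩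
  have hblock : b.1 = (a.1.1 + 1, a.1.2) ∧ c.1 = (a.1.1 + 1, a.1.2 + 1) ∧
      d.1 = (a.1.1, a.1.2 + 1) := by
    simp [a, b, c, d]
  have hac : a ≠ c := by simp [a, c]
  have hbd : b ≠ d := by simp [b, d]
  rcases h with ⟨hcol, h1, h2⟩ | ⟨hcol, h1, h2⟩
  · obtain ⟨D₁, D₂, T', hT', hD₁, hD₂, hbin, hind⟩ := hT.exists_rotate (a := a) (b := b) (c := c)
      (d := d) h1 h2 (by simp [a, d, LatticeAdj]) (by simp [b, c, LatticeAdj]) hac hbd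
    refine ⟨T', hT', fun K _ => ?_, fun x y => ?_, fun x y => ?_⟩
    · rw [hbin]
      exact Ideal.mul_mem_left _ _ (Ideal.subset_span ⟨D₁, D₂, ⟨a, b, c, d, hblock.1, hblock.2.1,
        hblock.2.2, Or.inl ⟨hD₁, hD₂⟩⟩, rfl⟩)
    · rw [hind, if_congr (e1 x y) rfl rfl, if_congr (e2 x y) rfl rfl, hcol]
      simp
    · rw [hind, if_congr (e3 x y) rfl rfl, if_congr (e4 x y) rfl rfl, hcol]
      simp
  · obtain ⟨D₁, D₂, T', hT', hD₁, hD₂, hbin, hind⟩ := hT.exists_rotate (a := a) (b := d) (c := c)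
      (d := b) h1 h2 (by simp [a, b, LatticeAdj]) (by simp [d, c, LatticeAdj]) hac hbd.symm
    refine ⟨T', hT', fun K _ => ?_, fun x y => ?_, fun x y => ?_⟩
    · rw [hbin]
      exact Ideal.mul_mem_left _ _ (Ideal.subset_span ⟨D₁, D₂, ⟨a, b, c, d, hblock.1, hblock.2.1,
        hblock.2.2, Or.inr ⟨hD₁, hD₂⟩⟩, rfl⟩)
    · rw [hind, if_congr (e2 x y) rfl rfl, if_congr (e1 x y) rfl rfl, hcol, if_neg not_false]
      ring
    · rw [hind, if_congr (e4 x y) rfl rfl, if_congr (e3 x y) rfl rfl, hcol, if_neg not_false]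
      ring

/-- A flip at an uppermost point where the first height function is above the second one brings the
two tilings closer together. -/
theorem IsStream.exists_flip {D : ℤ × ℤ → ℤ} (hR : R.IsSimplyConnected) (h₁ : R.IsTiling T₁)
    (hD : IsStream T₁ T₂ D) (hpos : ∃ w, 0 < D w) :
    ∃ (T' : Finset R.Domino) (D' : ℤ × ℤ → ℤ), R.IsTiling T' ∧ IsStream T' T₂ D' ∧
      (∀ (K : Type*) [Field K], R.binom K T₁ T' ∈ R.flipIdeal K) ∧
      ∑ w ∈ R, (D' w).natAbs < ∑ w ∈ R, (D w).natAbs := by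
  have hint : ∀ v, 0 < D v → R.IsInterior v := by
    intro v hv
    by_contra h
    rw [hD.eq_zero v h] at hv
    exact lt_irrefl _ hv
  obtain ⟨⟨i, j⟩, hv, hmax⟩ := hR.exists_local_max h₁ (P := {v | 0 < D v}) hpos hint (by
    intro v hv u hvu hstep
    -- The step rises by at least 1 for `T₁` and by at most 3 for `T₂`, so `4 * (D u - D v) ≥ -2`,
    -- whence `D u ≥ D v` by integrality.
    have h := hD.heightStep_sub hvu
    have := heightStep_le (T := T₂) v u
    simp only [Set.mem_ofPred_eq] at hv ⊢
    omega)
  simp only [Set.mem_ofPred_eq] at hv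
  obtain ⟨T', hT', hflip, hH, hV⟩ := h₁.exists_flip (hint _ hv) (parallel_of_local_max hmax)
  refine ⟨T', fun w => D w - if w = (i, j) then 1 else 0, hT', ⟨?_, ?_, ?_⟩, hflip, ?_⟩
  · intro x y
    have h := hD.vertical x y
    have hc := color_eq (i - 1, j)
    have hc' := color_eq (x - 1, y)
    rw [hH]
    simp only [Prod.mk.injEq] at hc hc' ⊢
    by_cases hx : x = i ∧ (y = j ∨ y = j - 1)
    · rw [if_pos hx]
      obtain ⟨rfl, rfl | rfl⟩ := hx
      · rw [if_pos (by simp), if_neg (by simp)]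
        rcases hc with ⟨e, -⟩ | ⟨e, -⟩ <;> rw [e] at h ⊢ <;> linarith
      · rw [if_neg (by simp), if_pos (by simp)]
        rcases hc with ⟨e, e'⟩ | ⟨e, e'⟩ <;> rcases hc' with ⟨f, f'⟩ | ⟨f, f'⟩ <;>
          first | omega | (rw [f] at h ⊢; rw [e]; linarith)
    · rw [if_neg hx, if_neg (by omega), if_neg (by omega)]
      linarith
  · intro x y
    have h := hD.horizontal x y
    have hc := color_eq (i - 1, j)
    have hc' := color_eq (x, y - 1)
    rw [hV]
    simp only [Prod.mk.injEq] at hc hc' ⊢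
    by_cases hx : y = j ∧ (x = i ∨ x = i - 1)
    · rw [if_pos hx]
      obtain ⟨rfl, rfl | rfl⟩ := hx
      · rw [if_neg (by simp), if_pos (by simp)]
        rcases hc with ⟨e, e'⟩ | ⟨e, e'⟩ <;> rcases hc' with ⟨f, f'⟩ | ⟨f, f'⟩ <;>
          first | omega | (rw [f] at h ⊢; rw [e]; linarith)
      · rw [if_pos (by simp), if_neg (by simp)]
        rcases hc with ⟨e, e'⟩ | ⟨e, e'⟩ <;> rcases hc' with ⟨f, f'⟩ | ⟨f, f'⟩ <;>
          first | omega | (rw [f] at h ⊢; rw [e]; linarith)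
    · rw [if_neg hx, if_neg (by omega), if_neg (by omega)]
      linarith
  · intro w hw
    have hne : w ≠ (i, j) := by
      rintro rfl
      exact hw (hint _ hv)
    simp [hD.eq_zero w hw, hne]
  -- An interior point is the lower left corner of a square of `R`, so the sum does include `(i,
  -- j)`, where `D` is positive and drops by one.
  · apply Finset.sum_lt_sum
    · intro w _
      simp only
      split_ifs with h
      · subst h
        omega
      · simp
    · refine ⟨(i, j), (hint _ hv).1, ?_⟩
      simp only [if_true]
      omega

/-! ### Membership in the ideals -/

variable (K : Type*) [Field K]

theorem binom_swap (D₁ D₂ : Finset R.Domino) : R.binom K D₂ D₁ = -R.binom K D₁ D₂ := by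
  simp [binom]

theorem binom_add_binom (D₁ D₂ D₃ : Finset R.Domino) :
    R.binom K D₁ D₂ + R.binom K D₂ D₃ = R.binom K D₁ D₃ := by
  simp [binom]

theorem IsStream.binom_mem_flipIdeal (hR : R.IsSimplyConnected) {D : ℤ × ℤ → ℤ}
    (h₁ : R.IsTiling T₁) (h₂ : R.IsTiling T₂) (hD : IsStream T₁ T₂ D) :
    R.binom K T₁ T₂ ∈ R.flipIdeal K := by
  induction hn : ∑ w ∈ R, (D w).natAbs using Nat.strong_induction_on generalizing T₁ T₂ D with
  | _ n ih =>
    subst hn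
    -- Stated for any pair with the same total, so that it also applies to `-D` with the tilings
    -- exchanged.
    have step : ∀ {T₁ T₂ : Finset R.Domino} {E : ℤ × ℤ → ℤ}, R.IsTiling T₁ → R.IsTiling T₂ →
        IsStream T₁ T₂ E → ∑ w ∈ R, (E w).natAbs = ∑ w ∈ R, (D w).natAbs → (∃ w, 0 < E w) →
        R.binom K T₁ T₂ ∈ R.flipIdeal K := by
      intro T₁ T₂ E h₁ h₂ hE hsum hpos
      obtain ⟨T', E', hT', hE', hflip, hlt⟩ := hE.exists_flip hR h₁ hpos
      rw [← binom_add_binom K T₁ T' T₂]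
      exact Ideal.add_mem _ (hflip K) (ih _ (hsum ▸ hlt) hT' h₂ hE' rfl)
    by_cases hpos : ∃ w, 0 < D w
    · exact step h₁ h₂ hD rfl hpos
    by_cases hneg : ∃ w, D w < 0
    · rw [binom_swap]
      refine neg_mem (step h₂ h₁ hD.swap (by simp) ?_)
      obtain ⟨w, hw⟩ := hneg
      exact ⟨w, by simpa using hw⟩
    · push Not at hpos hneg
      rw [hD.eq_of_eq_zero fun w => le_antisymm (hpos w) (hneg w)]
      simp [binom]

/-- Any two domino tilings of a simply connected region are congruent modulo the flip ideal. -/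
theorem IsSimplyConnected.binom_mem_flipIdeal (hR : R.IsSimplyConnected) (h₁ : R.IsTiling T₁)
    (h₂ : R.IsTiling T₂) : R.binom K T₁ T₂ ∈ R.flipIdeal K := by
  obtain ⟨D, hD⟩ := hR.exists_isStream h₁ h₂
  exact hD.binom_mem_flipIdeal K hR h₁ h₂

theorem monom_pair {D : Finset R.Domino} {a b c d : R} (hab : LatticeAdj a.1 b.1)
    (hdc : LatticeAdj d.1 c.1) (hac : a ≠ c) (had : a ≠ d)
    (hD : ∀ e : R.Domino, e ∈ D ↔ e.1 = s(a, b) ∨ e.1 = s(d, c)) :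
    R.monom K D = MvPolynomial.X (⟨s(a, b), hab⟩ : R.Domino) *
      MvPolynomial.X (⟨s(d, c), hdc⟩ : R.Domino) := by
  classical
  have : D = {(⟨s(a, b), hab⟩ : R.Domino), (⟨s(d, c), hdc⟩ : R.Domino)} := by
    ext e
    rw [hD, Finset.mem_insert, Finset.mem_singleton, Subtype.ext_iff, Subtype.ext_iff]
  rw [this, monom, Finset.prod_pair]
  intro h
  have := congrArg Subtype.val h
  simp only [Sym2.eq_iff] at this
  tauto

/-- Both monomials of a flip binomial are quadratic and map to the product of the variables of the
four squares of the block. -/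
theorem flipIdeal_le_quadraticIdeal : R.flipIdeal K ≤ R.quadraticIdeal K := by
  rw [flipIdeal, Ideal.span_le]
  rintro f ⟨D₁, D₂, ⟨a, b, c, d, hb, hc, hd, h⟩, rfl⟩
  have hab : LatticeAdj a.1 b.1 := by simp [LatticeAdj, hb]
  have hdc : LatticeAdj d.1 c.1 := by simp [LatticeAdj, hc, hd]
  have had : LatticeAdj a.1 d.1 := by simp [LatticeAdj, hd]
  have hbc : LatticeAdj b.1 c.1 := by simp [LatticeAdj, hb, hc]
  have nac : a ≠ c := fun h => by simpa [← h] using congrArg Prod.fst hc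
  have nad : a ≠ d := fun h => by simpa [← h] using congrArg Prod.snd hd
  have nab : a ≠ b := fun h => by simpa [← h] using congrArg Prod.fst hb
  refine Ideal.subset_span ⟨?_, ?_⟩
  · rw [toricIdeal, RingHom.mem_ker, binom]
    rcases h with ⟨h1, h2⟩ | ⟨h1, h2⟩
    · rw [monom_pair K hab hdc nac nad h1, monom_pair K had hbc nac nab h2]
      simp
      ring
    · rw [monom_pair K had hbc nac nab h1, monom_pair K hab hdc nac nad h2]
      simp
      ring
  · rcases h with ⟨h1, h2⟩ | ⟨h1, h2⟩
    · exact ⟨_, _, _, _, by rw [binom, monom_pair K hab hdc nac nad h1,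
        monom_pair K had hbc nac nab h2]⟩
    · exact ⟨_, _, _, _, by rw [binom, monom_pair K had hbc nac nab h1,
        monom_pair K hab hdc nac nad h2]⟩

end CubiculatedRegion

theorem theorem4p2 (K : Type*) [Field K] (R : CubiculatedRegion) (hR : R.IsSimplyConnected) :
    (∀ T₁ T₂ : Finset R.Domino, R.IsTiling T₁ → R.IsTiling T₂ → T₁ ≠ T₂ →
      R.binom K T₁ T₂ ∈ R.quadraticIdeal K ∧ R.binom K T₁ T₂ ∈ R.flipIdeal K) ∧
    R.tilingIdeal K ≤ R.flipIdeal K := by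
  refine ⟨fun T₁ T₂ h₁ h₂ _ => ?_, ?_⟩
  · have h := hR.binom_mem_flipIdeal K h₁ h₂
    exact ⟨CubiculatedRegion.flipIdeal_le_quadraticIdeal K h, h⟩
  · rw [CubiculatedRegion.tilingIdeal, Ideal.span_le]
    rintro f ⟨T₁, T₂, h₁, h₂, rfl⟩
    exact hR.binom_mem_flipIdeal K h₁ h₂
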